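/- Let $M=\mathbb R^2_{x,y}\times S^1_\theta$, $q_0=(0,0,0)$, and let $N=T^*_{q_0}M\cong\mathbb R^3$ be the domain of the exponential mapping of Euler's elastic problem ($\dot x=\cos\theta$, $\dot y=\sin\theta$, $\dot\theta=u$, $\frac12\int_0^1u^2\,dt\to\min$). For $\lambda\in N$ put $h_i(\lambda)=\langle\lambda,X_i(q_0)\rangle$, where $X_1=\cos\theta\,\partial_x+\sin\theta\,\partial_y$, $X_2=\partial_\theta$, $X_3=[X_1,X_2]=\sin\theta\,\partial_x-\cos\theta\,\partial_y$, and define $(\beta,c,r)$, $r\ge 0$, $\beta\in\mathbb R/2\pi\mathbb Z$, by $h_1=-r\cos\beta$, $h_3=-r\sin\beta$, $h_2=c$. Let $E=\frac{c^2}{2}-r\cos\beta$ and $$N_1=\{r\ne0,\ -r<E<r\},\quad N_2=\{r\neq 0,\ E>r\},\quad N_3=\{r\ne0,\ E=r,\ \beta\ne\pi\},\quad N_i^\pm=N_i\cap\{\operatorname{sgn}c=\pm1\}\ (i=2,3).$$ Let $K(k)$ be the complete elliptic integral of the first kind and $\operatorname{sn},\operatorname{cn},\operatorname{dn}$ Jacobi's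 elliptic functions of modulus $k$. Coordinates $(\varphi,k,r)$ are introduced by $$\lambda\in N_1:\quad \sin\tfrac\beta2=k\operatorname{sn}(\sqrt r\varphi,k),\ \ \cos\tfrac\beta2=\operatorname{dn}(\sqrt r\varphi,k),\ \ \tfrac c2=k\sqrt r\operatorname{cn}(\sqrt r\varphi,k),\quad k\in(0,1),\ \varphi\in\mathbb R/\tfrac{4K}{\sqrt r}\mathbb Z;$$ $$\lambda\in N_2^\pm:\quad \sin\tfrac\beta2=\pm\operatorname{sn}\big(\tfrac{\sqrt r\varphi}{k},k\big),\ \ \cos\tfrac\beta2=\operatorname{cn}\big(\tfrac{\sqrt r\varphi}{k},k\big),\ \ \tfrac c2=\pm\tfrac{\sqrt r}{k}\operatorname{dn}\big(\tfrac{\sqrt r\varphi}{k},k\big),\quad k\in(0,1),\ \varphi\in\mathbb R/\tfrac{2kK}{\sqrt r}\mathbb Z;$$ $$\lambda\in N_3^\pm:\quad \sin\tfrac\beta2=\pm\tanh(\sqrt r\varphi),\ \ \cos\tfrac\beta2=\frac1{\cosh(\sqrt r\varphi)},\ \ \tfrac c2=\pm\frac{\sqrt r}{\cosh(\sqrt r\varphi)},\quad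 k=1,\ \varphi\in\mathbb R$$ (for a suitable representative of $\beta$ modulo $2\pi$). Put $p=\frac{\sqrt r}{2}$, $\tau=\sqrt r(\varphi+\frac12)$ on $N_1\cup N_3$, and $p=\frac{\sqrt r}{2k}$, $\tau=\frac{\sqrt r}{k}(\varphi+\frac12)$ on $N_2$; thus $\tau$ is defined modulo $4K$ on $N_1$ and modulo $2K$ on $N_2$. For $k\in(0,1)$ let $p_1^1(k)$ be the first positive root $p$ of $$f_1(p,k)=\operatorname{sn}p\,\operatorname{dn}p-\Big(2\int_0^p\operatorname{dn}^2t\,dt-p\Big)\operatorname{cn}p=0$$ and $p_1(k)=\min(2K(k),p_1^1(k))$. Define $L_1,\dots,L_4\subset N$ as follows: $L_j$ is the union of - the points of $N_1$ with $k\in(0,1)$, $p\in(0,p_1(k))$ and $\tau\in((j-1)K,jK)$; - the points with $k\in(0,1)$, $p\in(0,K(k))$ lying in $N_2^+$ with $\tau\in(0,K)$ for $j=1$; in $N_2^-$ with $\tau\in(-K,0)$ for $j=2$; in $N_2^-$ with $\tau\in(0,K)$ for $j=3$; in $N_2^+$ with $\tau\in(-K,0)$ for $j=4$; - the points with $p\in(0,+\infty)$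 lying in $N_3^+$ with $\tau>0$ for $j=1$; in $N_3^-$ with $\tau<0$ for $j=2$; in $N_3^-$ with $\tau>0$ for $j=3$; in $N_3^+$ with $\tau<0$ for $j=4$. Then each of the sets $L_1,L_2,L_3,L_4$ is open in $N$ and arcwise connected. -/

import Mathlib

namespace Elastica

noncomputable section

/-! ### Jacobi elliptic functions of modulus `k ∈ (0, 1)` -/

/-- The elliptic integral of the first kind `F(u, k)`. -/
def ellF (u k : ℝ) : ℝ := ∫ t in (0 : ℝ)..u, 1 / √(1 - k ^ 2 * Real.sin t ^ 2)

/-- The complete elliptic integral of the first kind `K(k)`. -/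
def ellK (k : ℝ) : ℝ := ellF (Real.pi / 2) k

/-- Jacobi's amplitude `am(·, k)`: the inverse of the increasing bijection `F(·, k) : ℝ → ℝ`,
for `k ∈ (0, 1)`. -/
def am (p k : ℝ) : ℝ := Function.invFun (fun u => ellF u k) p

def sn (p k : ℝ) : ℝ := Real.sin (am p k)

def cn (p k : ℝ) : ℝ := Real.cos (am p k)

def dn (p k : ℝ) : ℝ := √(1 - k ^ 2 * sn p k ^ 2)

/-- Jacobi's epsilon function `E(p) = ∫₀ᵖ dn² t dt`. -/
def jacobiEpsilon (p k : ℝ) : ℝ := ∫ t in (0 : ℝ)..p, dn t k ^ 2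

def f₁ (p k : ℝ) : ℝ := sn p k * dn p k - (2 * jacobiEpsilon p k - p) * cn p k

/-- The first positive root of `f₁(·, k)`; it lies in `(K, 3K)`. -/
def p₁₁ (k : ℝ) : ℝ := sInf {p : ℝ | 0 < p ∧ f₁ p k = 0}

def p₁ (k : ℝ) : ℝ := min (2 * ellK k) (p₁₁ k)

/-! ### The preimage of the exponential mapping -/

/-- Tangent vectors of `M = ℝ² × S¹` in the coordinate frame `∂/∂x, ∂/∂y, ∂/∂θ`. -/
abbrev TangentM : Type := ℝ × ℝ × ℝ

/-- The preimage `N = T*_{q₀} M` of the exponential mapping, `q₀ = (0, 0, 0)`, with its usual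
topology of a finite-dimensional vector space. -/
abbrev N : Type := TangentM →L[ℝ] ℝ

/-- The vector field `X₁ = cos θ ∂/∂x + sin θ ∂/∂y` at `(x, y, θ)`. -/
def X₁ (θ : ℝ) : TangentM := (Real.cos θ, Real.sin θ, 0)

/-- The vector field `X₂ = ∂/∂θ`. -/
def X₂ (_θ : ℝ) : TangentM := (0, 0, 1)

/-- The vector field `X₃ = [X₁, X₂] = sin θ ∂/∂x - cos θ ∂/∂y` at `(x, y, θ)`. -/
def X₃ (θ : ℝ) : TangentM := (Real.sin θ, -Real.cos θ, 0)

def h₁ (lam : N) : ℝ := lam (X₁ 0)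

def h₂ (lam : N) : ℝ := lam (X₂ 0)

def h₃ (lam : N) : ℝ := lam (X₃ 0)

/-! The coordinates `(β, c, r)`: `h₁ = -r cos β`, `h₃ = -r sin β`, `h₂ = c`. -/

def rad (lam : N) : ℝ := √(h₁ lam ^ 2 + h₃ lam ^ 2)

/-- The angle `β` modulo `2π` (meaningful for `r ≠ 0`). -/
def beta (lam : N) : Real.Angle := (Complex.arg ⟨-h₁ lam, -h₃ lam⟩ : ℝ)

def vel (lam : N) : ℝ := h₂ lam

/-- The pendulum energy `E = c² / 2 - r cos β`. -/
def energy (lam : N) : ℝ := vel lam ^ 2 / 2 - rad lam * (beta lam).cos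

theorem h₁_eq (lam : N) : h₁ lam = -(rad lam * (beta lam).cos) := by
  have h := Complex.norm_mul_cos_arg ⟨-h₁ lam, -h₃ lam⟩
  have hn : ‖(⟨-h₁ lam, -h₃ lam⟩ : ℂ)‖ = rad lam := by
    rw [Complex.norm_def, Complex.normSq_apply, rad]; congr 1; ring
  rw [hn] at h
  simp only [beta, Real.Angle.cos_coe]
  linarith

theorem h₃_eq (lam : N) : h₃ lam = -(rad lam * (beta lam).sin) := by
  have h := Complex.norm_mul_sin_arg ⟨-h₁ lam, -h₃ lam⟩
  have hn : ‖(⟨-h₁ lam, -h₃ lam⟩ : ℂ)‖ = rad lam := by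
    rw [Complex.norm_def, Complex.normSq_apply, rad]; congr 1; ring
  rw [hn] at h
  simp only [beta, Real.Angle.sin_coe]
  linarith

def N₁ : Set N := {lam | rad lam ≠ 0 ∧ -rad lam < energy lam ∧ energy lam < rad lam}

def N₂ : Set N := {lam | rad lam ≠ 0 ∧ rad lam < energy lam}

def N₃ : Set N := {lam | rad lam ≠ 0 ∧ energy lam = rad lam ∧ beta lam ≠ (Real.pi : Real.Angle)}

/-- `N₂^±`, for the sign `s = ±1` of `c`. -/
def N₂s (s : SignType) : Set N := {lam | lam ∈ N₂ ∧ SignType.sign (vel lam) = s}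

/-- `N₃^±`, for the sign `s = ±1` of `c`. -/
def N₃s (s : SignType) : Set N := {lam | lam ∈ N₃ ∧ SignType.sign (vel lam) = s}

/-! ### Elliptic coordinates `(φ, k, r)` and the coordinates `(τ, p, k)`

The coordinates `φ` and `τ` are periodic (on `N₁` and `N₂`), so coordinates are given as relations:
a point is related to every representative of its coordinates. The real number `b` below is a
representative of the angle `β`. -/

/-- `(φ, k, r)` are elliptic coordinates of `lam ∈ N₁`. -/
def IsElliptic₁ (lam : N) (φ k r : ℝ) : Prop :=
  lam ∈ N₁ ∧ r = rad lam ∧ 0 < k ∧ k < 1 ∧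
    ∃ b : ℝ, (b : Real.Angle) = beta lam ∧
      Real.sin (b / 2) = k * sn (√r * φ) k ∧
      Real.cos (b / 2) = dn (√r * φ) k ∧
      vel lam / 2 = k * √r * cn (√r * φ) k

/-- `(φ, k, r)` are elliptic coordinates of `lam ∈ N₂^±`. -/
def IsElliptic₂ (s : SignType) (lam : N) (φ k r : ℝ) : Prop :=
  lam ∈ N₂s s ∧ r = rad lam ∧ 0 < k ∧ k < 1 ∧
    ∃ b : ℝ, (b : Real.Angle) = beta lam ∧
      Real.sin (b / 2) = (s : ℝ) * sn (√r * φ / k) k ∧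
      Real.cos (b / 2) = cn (√r * φ / k) k ∧
      vel lam / 2 = (s : ℝ) * (√r / k) * dn (√r * φ / k) k

/-- `(φ, 1, r)` are elliptic coordinates of `lam ∈ N₃^±`; for the modulus `k = 1` one has
`sn = tanh` and `cn = dn = 1 / cosh`. -/
def IsElliptic₃ (s : SignType) (lam : N) (φ r : ℝ) : Prop :=
  lam ∈ N₃s s ∧ r = rad lam ∧
    ∃ b : ℝ, (b : Real.Angle) = beta lam ∧
      Real.sin (b / 2) = (s : ℝ) * Real.tanh (√r * φ) ∧
      Real.cos (b / 2) = 1 / Real.cosh (√r * φ) ∧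
      vel lam / 2 = (s : ℝ) * √r * (1 / Real.cosh (√r * φ))

/-- `(τ, p, k)` are coordinates of `lam ∈ N₁`. -/
def HasCoords₁ (lam : N) (τ p k : ℝ) : Prop :=
  ∃ φ r : ℝ, IsElliptic₁ lam φ k r ∧ p = √r / 2 ∧ τ = √r * (φ + 1 / 2)

/-- `(τ, p, k)` are coordinates of `lam ∈ N₂^±`. -/
def HasCoords₂ (s : SignType) (lam : N) (τ p k : ℝ) : Prop :=
  ∃ φ r : ℝ, IsElliptic₂ s lam φ k r ∧ p = √r / (2 * k) ∧ τ = √r / k * (φ + 1 / 2)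

/-- `(τ, p, 1)` are coordinates of `lam ∈ N₃^±`. -/
def HasCoords₃ (s : SignType) (lam : N) (τ p : ℝ) : Prop :=
  ∃ φ r : ℝ, IsElliptic₃ s lam φ r ∧ p = √r / 2 ∧ τ = √r * (φ + 1 / 2)

/-! ### The domains `L₁, …, L₄` -/

/-- The points of `N₁` with `τ ∈ (a K, b K)`, `p ∈ (0, p₁)`, `k ∈ (0, 1)`. -/
def block₁ (a b : ℝ) : Set N :=
  {lam | ∃ τ p k : ℝ, HasCoords₁ lam τ p k ∧ τ ∈ Set.Ioo (a * ellK k) (b * ellK k) ∧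
    p ∈ Set.Ioo 0 (p₁ k) ∧ k ∈ Set.Ioo (0 : ℝ) 1}

/-- The points of `N₂^±` with `τ ∈ (a K, b K)`, `p ∈ (0, K)`, `k ∈ (0, 1)`. -/
def block₂ (s : SignType) (a b : ℝ) : Set N :=
  {lam | ∃ τ p k : ℝ, HasCoords₂ s lam τ p k ∧ τ ∈ Set.Ioo (a * ellK k) (b * ellK k) ∧
    p ∈ Set.Ioo 0 (ellK k) ∧ k ∈ Set.Ioo (0 : ℝ) 1}

/-- The points of `N₃^±` with `τ ∈ I`, `p ∈ (0, +∞)`. -/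
def block₃ (s : SignType) (I : Set ℝ) : Set N :=
  {lam | ∃ τ p : ℝ, HasCoords₃ s lam τ p ∧ τ ∈ I ∧ p ∈ Set.Ioi (0 : ℝ)}

def L₁ : Set N := block₁ 0 1 ∪ block₂ 1 0 1 ∪ block₃ 1 (Set.Ioi 0)

def L₂ : Set N := block₁ 1 2 ∪ block₂ (-1) (-1) 0 ∪ block₃ (-1) (Set.Iio 0)

def L₃ : Set N := block₁ 2 3 ∪ block₂ (-1) 0 1 ∪ block₃ (-1) (Set.Ioi 0)

def L₄ : Set N := block₁ 3 4 ∪ block₂ 1 (-1) 0 ∪ block₃ 1 (Set.Iio 0)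

end

end Elastica

/-!
The covector `λ` evolves along an extremal by the pendulum `β̇ = c`, `ċ = -r sin β`, and `φ` is its
phase, so `τ` is the phase at time `1 / 2`, at the midpoint of the elastica. The flow of the
pendulum up to this time is a homeomorphism of `N`, and it carries `Lⱼ` onto a set described without
elliptic coordinates: the signs of `h₃` and `h₂` select `j`, and the bound on `p` is a condition on
the pair `(κ, √r / 2)`, where `κ = √((E + r) / (2 r))` is `k` on `N₁`, `1` on `N₃` and `1 / k` on
`N₂`.

These pairs form an open set. Away from `κ = 1` this holds since `K` is continuous and `p₁` is lower
semicontinuous: on `(0, K / 2)` the function `f₁` stays positive, and on a compact interval below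
`p₁` it stays nonzero under small changes of `k`. At `κ = 1` it holds since `K ≤ p₁` and
`K(k) → ∞` as `k → 1`.

The dilation `(r, β, c) ↦ (s² r, β, s c)` preserves `κ` and the signs and shrinks `p`. It contracts
each region into the part of it in the unit ball, where the bound on `p` holds automatically, so
that this part is convex.
-/

namespace Elastica

open Function Set Filter Topology
open scoped NNReal

section Analysis

variable {E : Type*} [NormedAddCommGroup E] [NormedSpace ℝ E]

theorem continuousAt_parametric_primitive {X : Type*} [TopologicalSpace X] {U : Set X}
    (hU : IsOpen U) {f : ℝ → X → E} (hf : ∀ t, ∀ x ∈ U, ContinuousAt (uncurry f) (t, x))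
    (a u : ℝ) {x : X} (hx : x ∈ U) :
    ContinuousAt (fun q : ℝ × X => ∫ t in a..q.1, f t q.2) (u, x) := by
  have hcont : Continuous (uncurry fun (y : U) t => f t y) :=
    continuous_iff_continuousAt.2 fun q => (hf q.2 q.1 q.1.2).comp (x := q)
      (f := fun q : U × ℝ => (q.2, (q.1 : X))) (by fun_prop)
  have hemb : IsOpenEmbedding fun q : ℝ × U => (q.1, (q.2 : X)) :=
    IsOpenEmbedding.id.prodMap hU.isOpenEmbedding_subtypeVal
  refine (hemb.continuousAt_iff (x := (u, ⟨x, hx⟩))).1 ?_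
  exact ((intervalIntegral.continuous_parametric_primitive_of_continuous hcont).comp
    continuous_swap).continuousAt

theorem dist_le_of_isIntegralCurve {v : E → E} {K : ℝ≥0} {s : Set E} (hv : LipschitzOnWith K v s)
    {γ δ : ℝ → E} (hγ : IsIntegralCurve γ fun _ => v) (hδ : IsIntegralCurve δ fun _ => v)
    (hγs : ∀ t, γ t ∈ s) (hδs : ∀ t, δ t ∈ s) (t : ℝ) :
    dist (γ t) (δ t) ≤ dist (γ 0) (δ 0) * Real.exp (K * |t|) := by
  have hγt := hγ.comp_mul t
  have hδt := hδ.comp_mul t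
  have := dist_le_of_trajectories_ODE_of_mem (v := fun _ => t • v) (s := fun _ => s)
    (K := ‖t‖₊ * K) (a := 0) (b := 1) (f := γ ∘ (· * t)) (g := δ ∘ (· * t))
    (fun _ _ => (lipschitzWith_smul t).comp_lipschitzOnWith hv) hγt.continuous.continuousOn
    (fun τ _ => (hγt τ).hasDerivWithinAt) (fun _ _ => hγs _) hδt.continuous.continuousOn
    (fun τ _ => (hδt τ).hasDerivWithinAt) (fun _ _ => hδs _) le_rfl 1 (by simp)
  simpa [mul_comm] using this

theorem exists_dist_le_of_isIntegralCurve [ProperSpace E] {v : E → E} (hv : ContDiff ℝ 1 v)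
    (hbdd : ∀ ρ, ∃ R, ∀ γ, IsIntegralCurve γ (fun _ => v) → ‖γ 0‖ ≤ ρ → ∀ t, ‖γ t‖ ≤ R) (ρ : ℝ) :
    ∃ K : ℝ, ∀ γ δ, IsIntegralCurve γ (fun _ => v) → IsIntegralCurve δ (fun _ => v) →
      ‖γ 0‖ ≤ ρ → ‖δ 0‖ ≤ ρ → ∀ t, dist (γ t) (δ t) ≤ dist (γ 0) (δ 0) * Real.exp (K * |t|) := by
  obtain ⟨R, hR⟩ := hbdd ρ
  obtain ⟨K, hK⟩ := LocallyLipschitzOn.exists_lipschitzOnWith_of_compact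
    (isCompact_closedBall (0 : E) R) hv.locallyLipschitz.locallyLipschitzOn
  refine ⟨K, fun γ δ hγ hδ hγ₀ hδ₀ t => dist_le_of_isIntegralCurve hK hγ hδ ?_ ?_ t⟩
  · simpa using hR γ hγ hγ₀
  · simpa using hR δ hδ hδ₀

theorem exists_flow_of_exists_isIntegralCurve [ProperSpace E] {v : E → E} (hv : ContDiff ℝ 1 v)
    (hbdd : ∀ ρ, ∃ R, ∀ γ, IsIntegralCurve γ (fun _ => v) → ‖γ 0‖ ≤ ρ → ∀ t, ‖γ t‖ ≤ R)
    (hex : ∀ x, ∃ γ, IsIntegralCurve γ (fun _ => v) ∧ γ 0 = x) :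
    ∃ Φ : Flow ℝ E, ∀ γ, IsIntegralCurve γ (fun _ => v) → ∀ t, Φ t (γ 0) = γ t := by
  choose Φ hΦ hΦ₀ using hex
  have hgronwall := exists_dist_le_of_isIntegralCurve hv hbdd
  have hunique : ∀ γ, IsIntegralCurve γ (fun _ => v) → ∀ t, Φ (γ 0) t = γ t := fun γ hγ t => by
    obtain ⟨K, hK⟩ := hgronwall ‖γ 0‖
    simpa [hΦ₀] using hK (Φ (γ 0)) γ (hΦ _) hγ (by rw [hΦ₀]) le_rfl t
  have hcont : Continuous fun q : ℝ × E => Φ q.2 q.1 := by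
    refine continuous_iff_continuousAt.2 fun ⟨t, x⟩ => ?_
    obtain ⟨K, hK⟩ := hgronwall (‖x‖ + 1)
    have hnorm : ∀ᶠ q : ℝ × E in 𝓝 (t, x), ‖q.2‖ < ‖x‖ + 1 :=
      continuous_snd.norm.continuousAt.eventually_lt continuousAt_const (by simp)
    have hdist : ∀ᶠ q : ℝ × E in 𝓝 (t, x), dist (Φ q.2 q.1) (Φ x t) ≤
        dist q.2 x * Real.exp (K * |q.1|) + dist (Φ x q.1) (Φ x t) := by
      filter_upwards [hnorm] with q hq
      refine (dist_triangle _ (Φ x q.1) _).trans (add_le_add_left ?_ _)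
      simpa only [hΦ₀] using hK (Φ q.2) (Φ x) (hΦ _) (hΦ _) (by rw [hΦ₀]; exact hq.le)
        (by rw [hΦ₀]; linarith) q.1
    have hΦx : Continuous (Φ x) := (hΦ x).continuous
    have hbound : Continuous fun q : ℝ × E =>
      dist q.2 x * Real.exp (K * |q.1|) + dist (Φ x q.1) (Φ x t) := by fun_prop
    refine tendsto_iff_dist_tendsto_zero.2
      (squeeze_zero' (Eventually.of_forall fun _ => dist_nonneg) hdist ?_)
    simpa using hbound.tendsto (t, x)
  have hadd : ∀ t s x, Φ x (t + s) = Φ (Φ x s) t := fun t s x => by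
    simpa using (hunique _ ((hΦ x).comp_add s) t).symm
  exact ⟨⟨fun t x => Φ x t, hcont, hadd, hΦ₀⟩, hunique⟩

end Analysis

/-! ### Jacobi elliptic functions -/

theorem abs_lt_one_of_mem_Ioo {k : ℝ} (hk : k ∈ Ioo (0 : ℝ) 1) : |k| < 1 :=
  abs_lt.2 ⟨by linarith [hk.1], hk.2⟩

theorem radicand_pos {k : ℝ} (hk : |k| < 1) (t : ℝ) : 0 < 1 - k ^ 2 * Real.sin t ^ 2 := by
  have hk2 : k ^ 2 < 1 := (sq_lt_one_iff_abs_lt_one k).2 hk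
  nlinarith [Real.sin_sq_le_one t, sq_nonneg (Real.sin t), sq_nonneg k]

theorem continuousAt_ellF_integrand {k : ℝ} (hk : |k| < 1) (t : ℝ) :
    ContinuousAt (uncurry fun t k : ℝ => 1 / √(1 - k ^ 2 * Real.sin t ^ 2)) (t, k) := by
  have hne : √(1 - k ^ 2 * Real.sin t ^ 2) ≠ 0 := (Real.sqrt_pos.2 (radicand_pos hk t)).ne'
  unfold uncurry
  fun_prop (disch := exact hne)

theorem continuous_ellF_integrand {k : ℝ} (hk : |k| < 1) :
    Continuous fun t : ℝ => 1 / √(1 - k ^ 2 * Real.sin t ^ 2) :=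
  continuous_iff_continuousAt.2 fun t =>
    (continuousAt_ellF_integrand hk t).comp (f := fun t => (t, k)) (by fun_prop)

theorem one_le_ellF_integrand {k : ℝ} (hk : |k| < 1) (t : ℝ) :
    1 ≤ 1 / √(1 - k ^ 2 * Real.sin t ^ 2) := by
  rw [le_div_iff₀ (Real.sqrt_pos.2 (radicand_pos hk t)), one_mul]
  exact Real.sqrt_le_one.2 (by nlinarith [mul_nonneg (sq_nonneg k) (sq_nonneg (Real.sin t))])

theorem continuousAt_ellF {k : ℝ} (hk : |k| < 1) (u : ℝ) : ContinuousAt (uncurry ellF) (u, k) :=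
  continuousAt_parametric_primitive (U := {k | |k| < 1}) (isOpen_lt continuous_abs continuous_const)
    (fun t k (hk : |k| < 1) => continuousAt_ellF_integrand hk t) 0 u hk

theorem continuousAt_ellK {k : ℝ} (hk : |k| < 1) : ContinuousAt ellK k :=
  (continuousAt_ellF hk (Real.pi / 2)).comp (f := fun k => (Real.pi / 2, k)) (by fun_prop)

theorem hasDerivAt_ellF {k : ℝ} (hk : |k| < 1) (u : ℝ) :
    HasDerivAt (fun u => ellF u k) (1 / √(1 - k ^ 2 * Real.sin u ^ 2)) u :=
  ((continuous_ellF_integrand hk).integral_hasStrictDerivAt 0 u).hasDerivAt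

@[simp] theorem ellF_zero (k : ℝ) : ellF 0 k = 0 := by simp [ellF]

theorem strictMono_ellF {k : ℝ} (hk : |k| < 1) : StrictMono fun u => ellF u k :=
  strictMono_of_hasDerivAt_pos (hasDerivAt_ellF hk) fun u =>
    one_pos.trans_le (one_le_ellF_integrand hk u)

theorem monotone_ellF_sub_id {k : ℝ} (hk : |k| < 1) : Monotone fun u => ellF u k - u :=
  monotone_of_hasDerivAt_nonneg (fun u => (hasDerivAt_ellF hk u).sub (hasDerivAt_id u)) fun u =>
    sub_nonneg.2 (one_le_ellF_integrand hk u)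

theorem le_ellF {k : ℝ} (hk : |k| < 1) {u : ℝ} (hu : 0 ≤ u) : u ≤ ellF u k := by
  simpa using monotone_ellF_sub_id hk hu

theorem ellF_neg (u k : ℝ) : ellF (-u) k = -ellF u k := by
  rw [ellF, ellF, ← intervalIntegral.integral_symm, ← neg_zero,
    ← intervalIntegral.integral_comp_neg]
  simp

theorem surjective_ellF {k : ℝ} (hk : |k| < 1) : Surjective fun u => ellF u k := by
  have hcont : Continuous fun u => ellF u k :=
    continuous_iff_continuousAt.2 fun u => (hasDerivAt_ellF hk u).continuousAt
  refine hcont.surjective (tendsto_atTop_mono' _ ?_ tendsto_id)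
    (tendsto_atBot_mono' _ ?_ tendsto_id)
  · filter_upwards [eventually_ge_atTop 0] with u hu using le_ellF hk hu
  · filter_upwards [eventually_le_atBot 0] with u hu
    have := le_ellF hk (neg_nonneg.2 hu)
    rw [ellF_neg] at this
    exact neg_le_neg_iff.1 this

theorem ellF_pi_sub {k : ℝ} (hk : |k| < 1) (u : ℝ) :
    ellF (Real.pi - u) k = 2 * ellK k - ellF u k := by
  have hderiv : ∀ x, HasDerivAt (fun u => ellF (Real.pi - u) k + ellF u k) 0 x := fun x => by
    have := ((hasDerivAt_ellF hk (Real.pi - x)).comp x ((hasDerivAt_id x).const_sub Real.pi)).add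
      (hasDerivAt_ellF hk x)
    exact this.congr_deriv (by simp)
  have hconst := is_const_of_deriv_eq_zero (fun x => (hderiv x).differentiableAt)
    (fun x => (hderiv x).deriv) u (Real.pi / 2)
  simp only [sub_half] at hconst
  rw [ellK]
  linarith

theorem ellF_add_pi {k : ℝ} (hk : |k| < 1) (u : ℝ) :
    ellF (u + Real.pi) k = ellF u k + 2 * ellK k := by
  rw [add_comm, ← sub_neg_eq_add, ellF_pi_sub hk, ellF_neg]
  ring

theorem ellF_int_mul_pi_div_two {k : ℝ} (hk : |k| < 1) (n : ℤ) :
    ellF (n * (Real.pi / 2)) k = n * ellK k := by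
  have hper : Periodic (fun u => ellF u k - 2 * ellK k / Real.pi * u) Real.pi := fun u => by
    simp only [ellF_add_pi hk]
    field_simp
    ring
  obtain ⟨m, rfl | rfl⟩ := n.even_or_odd'
  · have := hper.int_mul m 0
    simp only [zero_add, ellF_zero, mul_zero, sub_zero, sub_eq_zero] at this
    push_cast
    rw [show 2 * (m : ℝ) * (Real.pi / 2) = m * Real.pi by ring, this]
    field_simp
  · have := hper.int_mul m (Real.pi / 2)
    simp only [sub_eq_iff_eq_add] at this
    push_cast
    rw [show (2 * (m : ℝ) + 1) * (Real.pi / 2) = Real.pi / 2 + m * Real.pi by ring, this, ellK]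
    field_simp
    ring

theorem pi_div_two_le_ellK {k : ℝ} (hk : |k| < 1) : Real.pi / 2 ≤ ellK k :=
  le_ellF hk (by positivity)

theorem ellK_pos {k : ℝ} (hk : |k| < 1) : 0 < ellK k :=
  Real.pi_div_two_pos.trans_le (pi_div_two_le_ellK hk)

theorem sqrt_radicand_le {k : ℝ} (hk : |k| < 1) {t : ℝ} (ht : t ≤ Real.pi / 2)
    (hcos : 0 ≤ Real.cos t) :
    √(1 - k ^ 2 * Real.sin t ^ 2) ≤ Real.pi / 2 - t + √(1 - k ^ 2) := by
  have hk2 : 0 < 1 - k ^ 2 := sub_pos.2 ((sq_lt_one_iff_abs_lt_one k).2 hk)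
  have hle : Real.cos t ≤ Real.pi / 2 - t := by
    rw [← Real.sin_pi_div_two_sub]
    exact Real.sin_le (sub_nonneg.2 ht)
  have hsq := Real.sq_sqrt hk2.le
  refine Real.sqrt_le_iff.2 ⟨add_nonneg (sub_nonneg.2 ht) (Real.sqrt_nonneg _), ?_⟩
  nlinarith [Real.sin_sq_add_cos_sq t, mul_nonneg (sub_nonneg.2 ht) (Real.sqrt_nonneg (1 - k ^ 2)),
    mul_nonneg hk2.le (sq_nonneg (Real.cos t))]

theorem log_le_ellK {k : ℝ} (hk : |k| < 1) : Real.log (√(1 - k ^ 2))⁻¹ ≤ ellK k := by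
  set d := √(1 - k ^ 2)
  have hd : 0 < d := Real.sqrt_pos.2 (sub_pos.2 ((sq_lt_one_iff_abs_lt_one k).2 hk))
  have hpi := Real.pi_div_two_pos
  have hint : ∫ t in (0 : ℝ)..Real.pi / 2, (Real.pi / 2 + d - t)⁻¹ =
      Real.log ((Real.pi / 2 + d) / d) := by
    rw [intervalIntegral.integral_comp_sub_left fun x => x⁻¹, integral_inv_of_pos (by linarith)
      (by linarith)]
    ring_nf
  have hle : ∀ t ∈ Icc 0 (Real.pi / 2),
      (Real.pi / 2 + d - t)⁻¹ ≤ 1 / √(1 - k ^ 2 * Real.sin t ^ 2) := fun t ht => by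
    rw [← one_div, add_sub_right_comm]
    exact one_div_le_one_div_of_le (Real.sqrt_pos.2 (radicand_pos hk t))
      (sqrt_radicand_le hk ht.2 (Real.cos_nonneg_of_neg_pi_div_two_le_of_le
        (by linarith [ht.1]) ht.2))
  calc Real.log d⁻¹ ≤ Real.log ((Real.pi / 2 + d) / d) := by
        refine Real.log_le_log (by positivity) ?_
        rw [inv_eq_one_div]
        gcongr
        linarith [Real.pi_gt_three]
    _ = ∫ t in (0 : ℝ)..Real.pi / 2, (Real.pi / 2 + d - t)⁻¹ := hint.symm
    _ ≤ ellK k := by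
        refine intervalIntegral.integral_mono_on hpi.le ?_
          ((continuous_ellF_integrand hk).intervalIntegrable _ _) hle
        refine ContinuousOn.intervalIntegrable fun t ht => ?_
        rw [uIcc_of_le hpi.le] at ht
        have hne : Real.pi / 2 + d - t ≠ 0 := by linarith [ht.2]
        fun_prop (disch := exact hne)

theorem tendsto_ellK_one : Tendsto ellK (𝓝[<] 1) atTop := by
  have hpos : ∀ᶠ k : ℝ in 𝓝[<] 1, |k| < 1 := by
    filter_upwards [Ioo_mem_nhdsLT (zero_lt_one (α := ℝ))] with k hk
    exact abs_lt_one_of_mem_Ioo hk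
  have hcompl : Tendsto (fun k : ℝ => √(1 - k ^ 2)) (𝓝[<] 1) (𝓝[>] 0) := by
    refine tendsto_nhdsWithin_iff.2 ⟨?_, ?_⟩
    · have hcont : Continuous fun k : ℝ => √(1 - k ^ 2) := by fun_prop
      simpa using (hcont.tendsto 1).mono_left nhdsWithin_le_nhds
    · filter_upwards [hpos] with k hk
      exact Real.sqrt_pos.2 (sub_pos.2 ((sq_lt_one_iff_abs_lt_one k).2 hk))
  exact tendsto_atTop_mono' _ (hpos.mono fun k => log_le_ellK)
    (Real.tendsto_log_atTop.comp (tendsto_inv_nhdsGT_zero.comp hcompl))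

theorem ellF_am {k : ℝ} (hk : |k| < 1) (p : ℝ) : ellF (am p k) k = p :=
  rightInverse_invFun (surjective_ellF hk) p

theorem am_ellF {k : ℝ} (hk : |k| < 1) (u : ℝ) : am (ellF u k) k = u :=
  leftInverse_invFun (strictMono_ellF hk).injective u

theorem lt_am_iff {k : ℝ} (hk : |k| < 1) {p u : ℝ} : u < am p k ↔ ellF u k < p := by
  rw [← (strictMono_ellF hk).lt_iff_lt, ellF_am hk]

theorem am_lt_iff {k : ℝ} (hk : |k| < 1) {p u : ℝ} : am p k < u ↔ p < ellF u k := by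
  rw [← (strictMono_ellF hk).lt_iff_lt, ellF_am hk]

theorem am_zero {k : ℝ} (hk : |k| < 1) : am 0 k = 0 := by
  simpa using am_ellF hk 0

theorem am_int_mul_ellK {k : ℝ} (hk : |k| < 1) (n : ℤ) : am (n * ellK k) k = n * (Real.pi / 2) := by
  rw [← ellF_int_mul_pi_div_two hk, am_ellF hk]

theorem sn_sq_add_cn_sq (p k : ℝ) : sn p k ^ 2 + cn p k ^ 2 = 1 := Real.sin_sq_add_cos_sq _

theorem dn_pos {k : ℝ} (hk : |k| < 1) (p : ℝ) : 0 < dn p k := Real.sqrt_pos.2 (radicand_pos hk _)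

theorem dn_sq {k : ℝ} (hk : |k| < 1) (p : ℝ) : dn p k ^ 2 = 1 - k ^ 2 * sn p k ^ 2 :=
  Real.sq_sqrt (radicand_pos hk _).le

theorem exists_sin_cos_eq {x y : ℝ} (h : x ^ 2 + y ^ 2 = 1) :
    ∃ ψ, Real.sin ψ = x ∧ Real.cos ψ = y := by
  have hnorm : ‖(⟨y, x⟩ : ℂ)‖ = 1 := by
    rw [Complex.norm_def, Complex.normSq_apply, Real.sqrt_eq_one]
    linarith
  exact ⟨_, by simpa [hnorm] using Complex.norm_mul_sin_arg ⟨y, x⟩,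
    by simpa [hnorm] using Complex.norm_mul_cos_arg ⟨y, x⟩⟩

theorem exists_sn_cn_eq {k : ℝ} (hk : |k| < 1) {x y : ℝ} (h : x ^ 2 + y ^ 2 = 1) :
    ∃ u, sn u k = x ∧ cn u k = y := by
  obtain ⟨ψ, hsin, hcos⟩ := exists_sin_cos_eq h
  exact ⟨ellF ψ k, by rw [sn, am_ellF hk, hsin], by rw [cn, am_ellF hk, hcos]⟩

theorem cn_pos {k : ℝ} (hk : |k| < 1) {p : ℝ} (hp : p ∈ Ioo (-ellK k) (ellK k)) : 0 < cn p k :=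
  Real.cos_pos_of_mem_Ioo
    ⟨(lt_am_iff hk).2 (by rw [ellF_neg]; exact hp.1), (am_lt_iff hk).2 hp.2⟩

theorem sn_pos {k : ℝ} (hk : |k| < 1) {p : ℝ} (hp : p ∈ Ioo 0 (2 * ellK k)) : 0 < sn p k := by
  refine Real.sin_pos_of_pos_of_lt_pi ((lt_am_iff hk).2 (by simpa using hp.1))
    ((am_lt_iff hk).2 ?_)
  simpa using hp.2.trans_eq (by simpa using (ellF_pi_sub hk 0).symm)

theorem continuousAt_am {k : ℝ} (hk : |k| < 1) (p : ℝ) : ContinuousAt (uncurry am) (p, k) := by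
  have hmod : ∀ᶠ q : ℝ × ℝ in 𝓝 (p, k), |q.2| < 1 :=
    continuous_snd.abs.continuousAt.eventually_lt continuousAt_const hk
  have hF : ∀ u, ContinuousAt (fun q : ℝ × ℝ => ellF u q.2) (p, k) := fun u =>
    (continuousAt_ellF hk u).comp (x := (p, k)) (f := fun q : ℝ × ℝ => (u, q.2)) (by fun_prop)
  refine tendsto_order.2 ⟨fun u hu => ?_, fun u hu => ?_⟩
  · filter_upwards [hmod, (hF u).eventually_lt continuousAt_fst ((lt_am_iff hk).1 hu)] with q hq h
    exact (lt_am_iff hq).2 h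
  · filter_upwards [hmod, continuousAt_fst.eventually_lt (hF u) ((am_lt_iff hk).1 hu)] with q hq h
    exact (am_lt_iff hq).2 h

theorem continuousAt_sn {k : ℝ} (hk : |k| < 1) (p : ℝ) : ContinuousAt (uncurry sn) (p, k) :=
  Real.continuous_sin.continuousAt.comp (continuousAt_am hk p)

theorem continuousAt_cn {k : ℝ} (hk : |k| < 1) (p : ℝ) : ContinuousAt (uncurry cn) (p, k) :=
  Real.continuous_cos.continuousAt.comp (continuousAt_am hk p)

theorem continuousAt_dn {k : ℝ} (hk : |k| < 1) (p : ℝ) : ContinuousAt (uncurry dn) (p, k) :=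
  (continuousAt_const.sub ((continuousAt_snd.pow 2).mul ((continuousAt_sn hk p).pow 2))).sqrt

theorem continuousAt_jacobiEpsilon {k : ℝ} (hk : |k| < 1) (p : ℝ) :
    ContinuousAt (uncurry jacobiEpsilon) (p, k) :=
  continuousAt_parametric_primitive (U := {k | |k| < 1}) (isOpen_lt continuous_abs continuous_const)
    (f := fun t k => dn t k ^ 2) (fun t _ hx => (continuousAt_dn hx t).fun_pow 2) 0 p hk

theorem hasDerivAt_am {k : ℝ} (hk : |k| < 1) (p : ℝ) :
    HasDerivAt (fun p => am p k) (dn p k) p := by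
  have hcont : ContinuousAt (fun p => am p k) p :=
    (continuousAt_am hk p).comp (f := fun p => (p, k)) (by fun_prop)
  have := HasDerivAt.of_local_left_inverse hcont (hasDerivAt_ellF hk (am p k))
    (one_pos.trans_le (one_le_ellF_integrand hk _)).ne' (Eventually.of_forall (ellF_am hk))
  simpa [dn, sn] using this

theorem hasDerivAt_sn {k : ℝ} (hk : |k| < 1) (p : ℝ) :
    HasDerivAt (fun p => sn p k) (cn p k * dn p k) p :=
  (hasDerivAt_am hk p).sin

theorem hasDerivAt_cn {k : ℝ} (hk : |k| < 1) (p : ℝ) :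
    HasDerivAt (fun p => cn p k) (-sn p k * dn p k) p :=
  (hasDerivAt_am hk p).cos

theorem hasDerivAt_dn {k : ℝ} (hk : |k| < 1) (p : ℝ) :
    HasDerivAt (fun p => dn p k) (-k ^ 2 * sn p k * cn p k) p := by
  have h := ((((hasDerivAt_sn hk p).pow 2).const_mul (k ^ 2)).const_sub 1).sqrt
    (radicand_pos hk (am p k)).ne'
  have hd := dn_pos hk p
  refine h.congr_deriv ?_
  change _ / (2 * dn p k) = _
  field_simp
  push_cast
  ring

theorem hasDerivAt_jacobiEpsilon {k : ℝ} (hk : |k| < 1) (p : ℝ) :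
    HasDerivAt (fun p => jacobiEpsilon p k) (dn p k ^ 2) p :=
  have hcont : Continuous fun t => dn t k ^ 2 := continuous_iff_continuousAt.2 fun t =>
    ((continuousAt_dn hk t).pow 2).comp (f := fun t => (t, k)) (by fun_prop)
  (hcont.integral_hasStrictDerivAt 0 p).hasDerivAt

/-! ### The first positive root of `f₁` -/

theorem continuousAt_f₁ {k : ℝ} (hk : |k| < 1) (p : ℝ) : ContinuousAt (uncurry f₁) (p, k) :=
  ((continuousAt_sn hk p).mul (continuousAt_dn hk p)).sub
    ((((continuousAt_jacobiEpsilon hk p).const_mul 2).sub continuousAt_fst).mul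
      (continuousAt_cn hk p))

theorem hasDerivAt_f₁ {k : ℝ} (hk : |k| < 1) (p : ℝ) :
    HasDerivAt (fun p => f₁ p k) ((2 * jacobiEpsilon p k - p) * sn p k * dn p k) p := by
  have h := ((hasDerivAt_sn hk p).mul (hasDerivAt_dn hk p)).sub
    ((((hasDerivAt_jacobiEpsilon hk p).const_mul 2).sub (hasDerivAt_id p)).mul
      (hasDerivAt_cn hk p))
  refine h.congr_deriv ?_
  simp only [id, Pi.sub_apply]
  linear_combination (-cn p k) * dn_sq hk p

theorem hasDerivAt_f₁_div_cn {k : ℝ} (hk : |k| < 1) {p : ℝ} (hp : cn p k ≠ 0) :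
    HasDerivAt (fun p => f₁ p k / cn p k) ((sn p k * dn p k / cn p k) ^ 2) p := by
  refine ((hasDerivAt_f₁ hk p).div (hasDerivAt_cn hk p) hp).congr_deriv ?_
  rw [f₁]
  field_simp
  ring

theorem f₁_pos {k : ℝ} (hk : |k| < 1) {p : ℝ} (hp : p ∈ Ioo 0 (ellK k)) : 0 < f₁ p k := by
  have hcn : ∀ x ∈ Icc 0 p, 0 < cn x k := fun x hx =>
    cn_pos hk ⟨by linarith [hx.1, ellK_pos hk], hx.2.trans_lt hp.2⟩
  have hderiv : ∀ x ∈ Icc 0 p, HasDerivAt (fun x => f₁ x k / cn x k) _ x := fun x hx =>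
    hasDerivAt_f₁_div_cn hk (hcn x hx).ne'
  have hmono : StrictMonoOn (fun x => f₁ x k / cn x k) (Icc 0 p) := by
    refine strictMonoOn_of_deriv_pos (convex_Icc _ _)
      (fun x hx => (hderiv x hx).continuousAt.continuousWithinAt) fun x hx => ?_
    rw [interior_Icc] at hx
    have hx' := Ioo_subset_Icc_self hx
    have hs : 0 < sn x k := sn_pos hk ⟨hx.1, by linarith [hx.2, hp.2, ellK_pos hk]⟩
    rw [(hderiv x hx').deriv]
    exact pow_pos (div_pos (mul_pos hs (dn_pos hk x)) (hcn x hx')) 2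
  have hlt := hmono (left_mem_Icc.2 hp.1.le) (right_mem_Icc.2 hp.1.le) hp.1
  have hzero : f₁ 0 k = 0 := by simp [f₁, sn, am_zero hk, jacobiEpsilon]
  simp only [hzero, zero_div] at hlt
  exact (div_pos_iff_of_pos_right (hcn p (right_mem_Icc.2 hp.1.le))).1 hlt

theorem f₁_ellK_pos {k : ℝ} (hk : |k| < 1) : 0 < f₁ (ellK k) k := by
  have ham : am (ellK k) k = Real.pi / 2 := am_ellF hk _
  simpa [f₁, sn, cn, ham] using dn_pos hk (ellK k)

theorem f₁_three_mul_ellK_neg {k : ℝ} (hk : |k| < 1) : f₁ (3 * ellK k) k < 0 := by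
  have ham : am (3 * ellK k) k = Real.pi / 2 + Real.pi := by
    rw [show Real.pi / 2 + Real.pi = ((3 : ℤ) : ℝ) * (Real.pi / 2) by push_cast; ring,
      ← am_int_mul_ellK hk, Int.cast_ofNat]
  simpa [f₁, sn, cn, ham, Real.sin_add_pi, Real.cos_add_pi] using dn_pos hk (3 * ellK k)

theorem exists_f₁_eq_zero {k : ℝ} (hk : |k| < 1) : ∃ p, 0 < p ∧ f₁ p k = 0 := by
  have hK := ellK_pos hk
  have hcont : ContinuousOn (fun p => f₁ p k) (Icc (ellK k) (3 * ellK k)) := fun p _ =>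
    (hasDerivAt_f₁ hk p).continuousAt.continuousWithinAt
  obtain ⟨p, hp, hp0⟩ := intermediate_value_Icc' (by linarith) hcont
    ⟨(f₁_three_mul_ellK_neg hk).le, (f₁_ellK_pos hk).le⟩
  exact ⟨p, hK.trans_le hp.1, hp0⟩

theorem le_p₁₁ {k q : ℝ} (hk : |k| < 1) (h : ∀ x ∈ Ioo 0 q, f₁ x k ≠ 0) : q ≤ p₁₁ k :=
  le_csInf (exists_f₁_eq_zero hk) fun x hx => not_lt.1 fun hlt => h x ⟨hx.1, hlt⟩ hx.2

theorem f₁_ne_zero {k x : ℝ} (hx : x ∈ Ioo 0 (p₁₁ k)) : f₁ x k ≠ 0 := fun h =>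
  notMem_of_lt_csInf hx.2 ⟨0, fun _ hy => hy.1.le⟩ ⟨hx.1, h⟩

theorem ellK_le_p₁ {k : ℝ} (hk : |k| < 1) : ellK k ≤ p₁ k :=
  le_min (by linarith [ellK_pos hk]) (le_p₁₁ hk fun _ hx => (f₁_pos hk hx).ne')

theorem lowerSemicontinuousAt_p₁₁ {k : ℝ} (hk : |k| < 1) : LowerSemicontinuousAt p₁₁ k := by
  intro p hp
  obtain ⟨q, hpq, hq⟩ := exists_between hp
  have hK := ellK_pos hk
  have hmod : ∀ᶠ k' in 𝓝 k, |k'| < 1 := continuous_abs.continuousAt.eventually_lt_const hk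
  have hfar : ∀ᶠ k' in 𝓝 k, ∀ x ∈ Icc (ellK k / 2) q, f₁ x k' ≠ 0 :=
    isCompact_Icc.eventually_forall_of_forall_eventually fun x hx =>
      ContinuousAt.eventually_ne (g := uncurry f₁ ∘ Prod.swap) (x := (k, x))
        (ContinuousAt.comp (continuousAt_f₁ hk x) continuous_swap.continuousAt)
        (f₁_ne_zero ⟨(half_pos hK).trans_le hx.1, hx.2.trans_lt hq⟩)
  have hnear : ∀ᶠ k' in 𝓝 k, ellK k / 2 < ellK k' :=
    (continuousAt_ellK hk).eventually_const_lt (by linarith)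
  filter_upwards [hmod, hfar, hnear] with k' hk' hfar hnear
  refine hpq.trans_le (le_p₁₁ hk' fun x hx => ?_)
  rcases lt_or_ge x (ellK k / 2) with h | h
  · exact (f₁_pos hk' ⟨hx.1, h.trans hnear⟩).ne'
  · exact hfar x ⟨h, hx.2.le⟩

theorem lowerSemicontinuousAt_p₁ {k : ℝ} (hk : |k| < 1) : LowerSemicontinuousAt p₁ k :=
  ((continuousAt_ellK hk).const_mul 2).lowerSemicontinuousAt.inf (lowerSemicontinuousAt_p₁₁ hk)

/-- The bound on `p` in the definition of the domains `Lⱼ`, written uniformly for the three types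
of motion as a condition on the pair `(κ, √r / 2)`, where `κ` is `k` on `N₁`, `1` on `N₃` and
`1 / k` on `N₂`; thus `p` is `√r / 2` on `N₁` and `κ * (√r / 2)` on `N₂`. -/
def stableParams : Set (ℝ × ℝ) :=
  {q | 0 < q.1 ∧ (q.1 < 1 → q.2 < p₁ q.1) ∧ (1 < q.1 → q.1 * q.2 < ellK q.1⁻¹)}

theorem mem_stableParams_iff_of_lt_one {κ x : ℝ} (h0 : 0 < κ) (h1 : κ < 1) :
    (κ, x) ∈ stableParams ↔ x < p₁ κ := by
  simp [stableParams, h0, h1, h1.not_gt]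

theorem mem_stableParams_iff_of_one_lt {κ x : ℝ} (h1 : 1 < κ) :
    (κ, x) ∈ stableParams ↔ κ * x < ellK κ⁻¹ := by
  simp [stableParams, one_pos.trans h1, h1, h1.not_gt]

theorem one_mem_stableParams (x : ℝ) : (1, x) ∈ stableParams := by
  simp [stableParams]

theorem abs_inv_lt_one {κ : ℝ} (h : 1 < κ) : |κ⁻¹| < 1 := by
  rw [abs_of_pos (inv_pos.2 (one_pos.trans h))]
  exact inv_lt_one_of_one_lt₀ h

theorem eventually_lt_ellK_nhds_one (M : ℝ) : ∀ᶠ k in 𝓝 (1 : ℝ), k < 1 → M < ellK k :=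
  eventually_nhdsWithin_iff.1 (tendsto_ellK_one.eventually_gt_atTop M)

theorem stableParams_mem_nhds_of_lt_one {κ x : ℝ} (h0 : 0 < κ) (h1 : κ < 1)
    (h : (κ, x) ∈ stableParams) : stableParams ∈ 𝓝 (κ, x) := by
  obtain ⟨y, hxy, hy⟩ := exists_between ((mem_stableParams_iff_of_lt_one h0 h1).1 h)
  have hp₁ : ∀ᶠ q : ℝ × ℝ in 𝓝 (κ, x), y < p₁ q.1 :=
    (lowerSemicontinuousAt_p₁ (abs_lt_one_of_mem_Ioo ⟨h0, h1⟩) y hy).prod_inl_nhds x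
  filter_upwards [hp₁, continuousAt_fst.eventually_const_lt h0,
    continuousAt_fst.eventually_lt_const h1, continuousAt_snd.eventually_lt_const hxy]
    with q hp₁ hpos hlt hq
  exact (mem_stableParams_iff_of_lt_one hpos hlt).2 (hq.trans hp₁)

theorem stableParams_mem_nhds_of_one_lt {κ x : ℝ} (h1 : 1 < κ) (h : (κ, x) ∈ stableParams) :
    stableParams ∈ 𝓝 (κ, x) := by
  have hK : ContinuousAt (fun q : ℝ × ℝ => ellK q.1⁻¹) (κ, x) :=
    ContinuousAt.comp (f := fun q : ℝ × ℝ => q.1⁻¹) (continuousAt_ellK (abs_inv_lt_one h1))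
      (continuousAt_fst.inv₀ (one_pos.trans h1).ne')
  filter_upwards [continuousAt_fst.eventually_const_lt h1, (continuousAt_fst.mul
    continuousAt_snd).eventually_lt hK ((mem_stableParams_iff_of_one_lt h1).1 h)] with q hone hq
  exact (mem_stableParams_iff_of_one_lt hone).2 hq

theorem stableParams_mem_nhds_one (x : ℝ) : stableParams ∈ 𝓝 (1, x) := by
  have hosc : ∀ᶠ q : ℝ × ℝ in 𝓝 (1, x), q.1 < 1 → x + 1 < ellK q.1 :=
    (eventually_lt_ellK_nhds_one _).prod_inl_nhds x
  have hinv : Tendsto (fun q : ℝ × ℝ => q.1⁻¹) (𝓝 (1, x)) (𝓝 1) := by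
    have : ContinuousAt (fun q : ℝ × ℝ => q.1⁻¹) (1, x) := continuousAt_fst.inv₀ one_ne_zero
    simpa [ContinuousAt] using this
  have hrot : ∀ᶠ q : ℝ × ℝ in 𝓝 (1, x), q.1⁻¹ < 1 → x + 1 < ellK q.1⁻¹ :=
    hinv.eventually (eventually_lt_ellK_nhds_one _)
  have hmul : ∀ᶠ q : ℝ × ℝ in 𝓝 (1, x), q.1 * q.2 < x + 1 :=
    (continuous_fst.mul continuous_snd).continuousAt.eventually_lt_const (by simp)
  filter_upwards [hosc, hrot, hmul, continuousAt_fst.eventually_const_lt one_pos,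
    continuousAt_snd.eventually_lt_const (lt_add_one x)] with q hosc hrot hmul hpos hq
  refine ⟨hpos, fun h => ?_, fun h => hmul.trans (hrot (inv_lt_one_of_one_lt₀ h))⟩
  exact hq.trans ((hosc h).trans_le (ellK_le_p₁ (abs_lt_one_of_mem_Ioo ⟨hpos, h⟩)))

theorem isOpen_stableParams : IsOpen stableParams := by
  refine isOpen_iff_mem_nhds.2 fun ⟨κ, x⟩ hq => ?_
  rcases lt_trichotomy κ 1 with h | rfl | h
  · exact stableParams_mem_nhds_of_lt_one hq.1 h hq
  · exact stableParams_mem_nhds_one x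
  · exact stableParams_mem_nhds_of_one_lt h hq

theorem mem_stableParams_of_le {κ x y : ℝ} (hx : (κ, x) ∈ stableParams) (hyx : y ≤ x) :
    (κ, y) ∈ stableParams :=
  ⟨hx.1, fun h => hyx.trans_lt (hx.2.1 h),
    fun h => (mul_le_mul_of_nonneg_left hyx hx.1.le).trans_lt (hx.2.2 h)⟩

theorem mem_stableParams_of_le_one {κ x : ℝ} (hκ : 0 < κ) (hx : x ≤ 1) (hκx : κ * x ≤ 1) :
    (κ, x) ∈ stableParams := by
  have hK : ∀ {k : ℝ}, |k| < 1 → 1 < ellK k := fun hk =>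
    lt_of_lt_of_le (by linarith [Real.pi_gt_three]) (pi_div_two_le_ellK hk)
  refine ⟨hκ, fun h => ?_, fun h => hκx.trans_lt (hK (abs_inv_lt_one h))⟩
  have hk : |κ| < 1 := abs_lt_one_of_mem_Ioo ⟨hκ, h⟩
  exact hx.trans_lt ((hK hk).trans_le (ellK_le_p₁ hk))

/-! ### Covectors and their half-angle coordinates -/

/-- The covector with vertical coordinates `h₁ = a`, `h₃ = b`, `h₂ = c`. -/
noncomputable def covector (a b c : ℝ) : N :=
  a • ContinuousLinearMap.fst ℝ ℝ (ℝ × ℝ) -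
    b • (ContinuousLinearMap.fst ℝ ℝ ℝ).comp (ContinuousLinearMap.snd ℝ ℝ (ℝ × ℝ)) +
    c • (ContinuousLinearMap.snd ℝ ℝ ℝ).comp (ContinuousLinearMap.snd ℝ ℝ (ℝ × ℝ))

@[simp]
theorem h₁_covector (a b c : ℝ) : h₁ (covector a b c) = a := by
  simp [h₁, X₁, covector]

@[simp]
theorem h₃_covector (a b c : ℝ) : h₃ (covector a b c) = b := by
  simp [h₃, X₃, covector]

@[simp]
theorem h₂_covector (a b c : ℝ) : h₂ (covector a b c) = c := by
  simp [h₂, X₂, covector]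

@[simp]
theorem covector_h (lam : N) : covector (h₁ lam) (h₃ lam) (h₂ lam) = lam := by
  have h : lam (0, -1, 0) = -lam (0, 1, 0) := by rw [← map_neg]; simp
  ext <;> simp [covector, h₁, h₂, h₃, X₁, X₂, X₃, h, ← Prod.mk_zero_zero]

theorem covector_inj {a b c a' b' c' : ℝ} :
    covector a b c = covector a' b' c' ↔ a = a' ∧ b = b' ∧ c = c' := by
  refine ⟨fun h => ⟨?_, ?_, ?_⟩, by rintro ⟨rfl, rfl, rfl⟩; rfl⟩
  · simpa using congrArg h₁ h
  · simpa using congrArg h₃ h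
  · simpa using congrArg h₂ h

theorem rad_nonneg (lam : N) : 0 ≤ rad lam := Real.sqrt_nonneg _

theorem energy_eq (lam : N) : energy lam = h₂ lam ^ 2 / 2 + h₁ lam := by
  rw [energy, h₁_eq, vel, sub_eq_add_neg]

/-- The covector whose coordinates are given by `r`, `A = sin (β / 2)`, `B = cos (β / 2)` and
`v = c / 2`. -/
noncomputable def ofHalfAngle (r A B v : ℝ) : N :=
  covector (-(r * (1 - 2 * A ^ 2))) (-(2 * r * A * B)) (2 * v)

section ofHalfAngle

variable {r A B v : ℝ} {lam : N}

@[simp]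
theorem h₁_ofHalfAngle : h₁ (ofHalfAngle r A B v) = -(r * (1 - 2 * A ^ 2)) := h₁_covector ..

@[simp]
theorem h₃_ofHalfAngle : h₃ (ofHalfAngle r A B v) = -(2 * r * A * B) := h₃_covector ..

@[simp]
theorem h₂_ofHalfAngle : h₂ (ofHalfAngle r A B v) = 2 * v := h₂_covector ..

theorem rad_ofHalfAngle (hr : 0 ≤ r) (hAB : A ^ 2 + B ^ 2 = 1) :
    rad (ofHalfAngle r A B v) = r := by
  rw [rad, h₁_ofHalfAngle, h₃_ofHalfAngle, Real.sqrt_eq_iff_mul_self_eq (by positivity) hr]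
  linear_combination (4 * r ^ 2 * A ^ 2) * hAB

theorem eq_ofHalfAngle_of_coe_eq_beta {b : ℝ} (hb : (b : Real.Angle) = beta lam) :
    lam = ofHalfAngle (rad lam) (Real.sin (b / 2)) (Real.cos (b / 2)) (vel lam / 2) := by
  have hcos : (beta lam).cos = 1 - 2 * Real.sin (b / 2) ^ 2 := by
    rw [← hb, Real.Angle.cos_coe, ← mul_div_cancel₀ b two_ne_zero, Real.cos_two_mul,
      mul_div_cancel₀ b two_ne_zero, Real.cos_sq']
    ring
  have hsin : (beta lam).sin = 2 * Real.sin (b / 2) * Real.cos (b / 2) := by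
    rw [← hb, Real.Angle.sin_coe, ← Real.sin_two_mul, mul_div_cancel₀ b two_ne_zero]
  rw [← covector_h lam, ofHalfAngle, covector_inj, covector_h, h₁_eq, h₃_eq, hcos, hsin, vel]
  exact ⟨rfl, by ring, by ring⟩

theorem exists_eq_ofHalfAngle (lam : N) : ∃ A B : ℝ, A ^ 2 + B ^ 2 = 1 ∧ 0 ≤ B ∧
    lam = ofHalfAngle (rad lam) A B (vel lam / 2) := by
  obtain ⟨hneg, hle⟩ := (beta lam).toReal_mem_Ioc
  exact ⟨_, _, Real.sin_sq_add_cos_sq _,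
    Real.cos_nonneg_of_neg_pi_div_two_le_of_le (by linarith) (by linarith),
    eq_ofHalfAngle_of_coe_eq_beta (beta lam).coe_toReal⟩

theorem eq_ofHalfAngle_iff (hr : 0 < r) (hAB : A ^ 2 + B ^ 2 = 1) :
    lam = ofHalfAngle r A B v ↔ r = rad lam ∧ ∃ b : ℝ, (b : Real.Angle) = beta lam ∧
      Real.sin (b / 2) = A ∧ Real.cos (b / 2) = B ∧ vel lam / 2 = v := by
  constructor
  · intro h
    obtain ⟨ψ, hsin, hcos⟩ := exists_sin_cos_eq hAB
    have hrad : r = rad lam := by rw [h, rad_ofHalfAngle hr.le hAB]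
    have h1 : h₁ lam = -(r * (1 - 2 * A ^ 2)) := h ▸ h₁_ofHalfAngle
    have h3 : h₃ lam = -(2 * r * A * B) := h ▸ h₃_ofHalfAngle
    have h2 : vel lam = 2 * v := by rw [vel, h, h₂_ofHalfAngle]
    rw [h₁_eq, ← hrad] at h1
    rw [h₃_eq, ← hrad] at h3
    refine ⟨hrad, 2 * ψ, ?_, by simpa using hsin, by simpa using hcos, by rw [h2]; ring⟩
    rw [← (beta lam).coe_toReal]
    refine Real.Angle.cos_sin_inj (mul_left_cancel₀ hr.ne' ?_) (mul_left_cancel₀ hr.ne' ?_)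
    · rw [Real.cos_two_mul, hcos, Real.Angle.cos_toReal]
      linear_combination (2 * r) * hAB + h1
    · rw [Real.sin_two_mul, hcos, hsin, Real.Angle.sin_toReal]
      linear_combination h3
  · rintro ⟨rfl, b, hb, rfl, rfl, rfl⟩
    exact eq_ofHalfAngle_of_coe_eq_beta hb

end ofHalfAngle

/-- The modulus `κ = √((E + r) / (2 r))`, equal to `k` on `N₁`, to `1` on `N₃` and to `1 / k`
on `N₂`. -/
noncomputable def modulus (lam : N) : ℝ := √((energy lam + rad lam) / (2 * rad lam))

theorem modulus_ofHalfAngle {r A B v : ℝ} (hr : 0 < r) (hAB : A ^ 2 + B ^ 2 = 1) :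
    modulus (ofHalfAngle r A B v) = √(A ^ 2 + v ^ 2 / r) := by
  rw [modulus, energy_eq, rad_ofHalfAngle hr.le hAB, h₁_ofHalfAngle, h₂_ofHalfAngle]
  congr 1
  field

variable {lam : N}

theorem mem_N₁_iff : lam ∈ N₁ ↔ 0 < rad lam ∧ 0 < modulus lam ∧ modulus lam < 1 := by
  refine (and_congr (rad_nonneg lam).lt_iff_ne'.symm Iff.rfl).trans (and_congr_right fun hr => ?_)
  rw [modulus, Real.sqrt_pos, Real.sqrt_lt' one_pos, one_pow, div_lt_one (by positivity),
    div_pos_iff_of_pos_right (by positivity)]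
  constructor <;> rintro ⟨_, _⟩ <;> constructor <;> linarith

theorem mem_N₂_iff : lam ∈ N₂ ↔ 0 < rad lam ∧ 1 < modulus lam := by
  refine (and_congr (rad_nonneg lam).lt_iff_ne'.symm Iff.rfl).trans (and_congr_right fun hr => ?_)
  rw [modulus, Real.lt_sqrt zero_le_one, one_pow, one_lt_div (by positivity)]
  constructor <;> intro <;> linarith

theorem mem_N₃_iff :
    lam ∈ N₃ ↔ 0 < rad lam ∧ modulus lam = 1 ∧ beta lam ≠ (Real.pi : Real.Angle) := by
  refine (and_congr (rad_nonneg lam).lt_iff_ne'.symm Iff.rfl).trans (and_congr_right fun hr => ?_)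
  rw [modulus, Real.sqrt_eq_one, div_eq_one_iff_eq (by positivity), two_mul, add_left_inj]

theorem beta_ofHalfAngle_ne_pi {r A B v : ℝ} (hr : 0 < r) (hAB : A ^ 2 + B ^ 2 = 1)
    (hB : B ≠ 0) : beta (ofHalfAngle r A B v) ≠ (Real.pi : Real.Angle) := by
  intro h
  have h1 := h₁_eq (ofHalfAngle r A B v)
  rw [h, rad_ofHalfAngle hr.le hAB, h₁_ofHalfAngle, Real.Angle.cos_coe, Real.cos_pi,
    neg_inj] at h1
  have := mul_left_cancel₀ hr.ne' h1
  exact hB (pow_eq_zero_iff two_ne_zero |>.1 (by linarith))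

/-! ### The pendulum flow -/

/-- The vertical part `ḣ₁ = -h₂ h₃`, `ḣ₃ = h₁ h₂`, `ḣ₂ = h₃` of the Hamiltonian system of the
maximum principle. Where `r ≠ 0` it is the pendulum `β̇ = c`, `ċ = -r sin β`, `ṙ = 0`. -/
noncomputable def pendulum (lam : N) : N :=
  covector (-(h₂ lam * h₃ lam)) (h₁ lam * h₂ lam) (h₃ lam)

theorem contDiff_pendulum : ContDiff ℝ 1 pendulum := by
  unfold pendulum covector h₁ h₂ h₃
  fun_prop

theorem pendulum_eq_zero_of_rad_eq_zero {lam : N} (h : rad lam = 0) : pendulum lam = 0 := by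
  rw [pendulum, h₁_eq, h₃_eq, h]
  simp [covector]

theorem pendulum_eq_zero_of_h₃_eq_zero {lam : N} (h3 : h₃ lam = 0) (h2 : h₂ lam = 0) :
    pendulum lam = 0 := by
  simp [pendulum, h3, h2, covector]

theorem isIntegralCurve_ofHalfAngle {A B V A' B' V' : ℝ → ℝ} {r ω : ℝ}
    (hAB : ∀ u, A u ^ 2 + B u ^ 2 = 1) (hA : ∀ u, HasDerivAt A (A' u) u)
    (hB : ∀ u, HasDerivAt B (B' u) u) (hV : ∀ u, HasDerivAt V (V' u) u)
    (hA' : ∀ u, ω * A' u = V u * B u) (hB' : ∀ u, ω * B' u = -(V u * A u))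
    (hV' : ∀ u, ω * V' u = -(r * A u * B u)) (u : ℝ) :
    IsIntegralCurve (fun t => ofHalfAngle r (A (ω * t + u)) (B (ω * t + u)) (V (ω * t + u)))
      fun _ => pendulum := by
  intro t
  have hlin : HasDerivAt (fun t => ω * t + u) ω t := by
    simpa using ((hasDerivAt_id t).const_mul ω).add_const u
  have hAt := (hA (ω * t + u)).comp t hlin
  have hBt := (hB (ω * t + u)).comp t hlin
  have hVt := (hV (ω * t + u)).comp t hlin
  refine (((((hAt.pow 2).const_mul 2).const_sub 1).const_mul r).neg.smul_const _ |>.sub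
    (((hAt.const_mul (2 * r)).mul hBt).neg.smul_const _) |>.add
    ((hVt.const_mul 2).smul_const _)).congr_deriv ?_
  change covector _ _ _ = covector _ _ _
  simp only [covector_inj, h₁_ofHalfAngle, h₂_ofHalfAngle, h₃_ofHalfAngle, comp_apply]
  specialize hAB (ω * t + u)
  specialize hA' (ω * t + u)
  specialize hB' (ω * t + u)
  specialize hV' (ω * t + u)
  refine ⟨?_, ?_, ?_⟩
  · push_cast
    linear_combination 4 * r * A (ω * t + u) * hA'
  · linear_combination -(2 * r * B (ω * t + u)) * hA' - 2 * r * A (ω * t + u) * hB' -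
      2 * r * V (ω * t + u) * hAB
  · linear_combination 2 * hV'

section integralCurve

variable {γ : ℝ → N}

theorem hasDerivAt_apply_of_isIntegralCurve (hγ : IsIntegralCurve γ fun _ => pendulum)
    (x : TangentM) (t : ℝ) : HasDerivAt (fun t => γ t x) (pendulum (γ t) x) t := by
  simpa using (hγ t).clm_apply (hasDerivAt_const t x)

theorem h₁_sq_add_h₃_sq_eq (hγ : IsIntegralCurve γ fun _ => pendulum) (t : ℝ) :
    h₁ (γ t) ^ 2 + h₃ (γ t) ^ 2 = h₁ (γ 0) ^ 2 + h₃ (γ 0) ^ 2 := by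
  have hd : ∀ t, HasDerivAt (fun t => h₁ (γ t) ^ 2 + h₃ (γ t) ^ 2) 0 t := fun t => by
    have h1 : HasDerivAt (fun t => h₁ (γ t)) (h₁ (pendulum (γ t))) t :=
      hasDerivAt_apply_of_isIntegralCurve hγ _ t
    have h3 : HasDerivAt (fun t => h₃ (γ t)) (h₃ (pendulum (γ t))) t :=
      hasDerivAt_apply_of_isIntegralCurve hγ _ t
    exact ((h1.pow 2).add (h3.pow 2)).congr_deriv (by simp [pendulum]; ring)
  exact is_const_of_deriv_eq_zero (fun t => (hd t).differentiableAt) (fun t => (hd t).deriv) t 0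

theorem energy_eq_energy_zero (hγ : IsIntegralCurve γ fun _ => pendulum) (t : ℝ) :
    energy (γ t) = energy (γ 0) := by
  have hd : ∀ t, HasDerivAt (fun t => energy (γ t)) 0 t := fun t => by
    have h1 : HasDerivAt (fun t => h₁ (γ t)) (h₁ (pendulum (γ t))) t :=
      hasDerivAt_apply_of_isIntegralCurve hγ _ t
    have h2 : HasDerivAt (fun t => h₂ (γ t)) (h₂ (pendulum (γ t))) t :=
      hasDerivAt_apply_of_isIntegralCurve hγ _ t
    simp only [energy_eq]
    exact (((h2.pow 2).div_const 2).add h1).congr_deriv (by simp [pendulum]; ring)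
  exact is_const_of_deriv_eq_zero (fun t => (hd t).differentiableAt) (fun t => (hd t).deriv) t 0

theorem norm_le_abs_h (lam : N) : ‖lam‖ ≤ |h₁ lam| + |h₃ lam| + |h₂ lam| := by
  refine lam.opNorm_le_bound (by positivity) fun ⟨x, y, z⟩ => ?_
  obtain ⟨hx, hy, hz⟩ : |x| ≤ ‖(x, y, z)‖ ∧ |y| ≤ ‖(x, y, z)‖ ∧ |z| ≤ ‖(x, y, z)‖ := by
    simp [Prod.norm_def]
  have happly : lam (x, y, z) = h₁ lam * x - h₃ lam * y + h₂ lam * z := by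
    conv_lhs => rw [← covector_h lam]
    simp [covector]
  calc ‖lam (x, y, z)‖ ≤ |h₁ lam| * |x| + |h₃ lam| * |y| + |h₂ lam| * |z| := by
        rw [happly, Real.norm_eq_abs, ← abs_mul, ← abs_mul, ← abs_mul]
        exact (abs_add_le _ _).trans (add_le_add_left (abs_sub _ _) _)
    _ ≤ |h₁ lam| * ‖(x, y, z)‖ + |h₃ lam| * ‖(x, y, z)‖ + |h₂ lam| * ‖(x, y, z)‖ := by gcongr
    _ = _ := by ring

theorem abs_apply_le_norm (lam : N) {x : TangentM} (hx : ‖x‖ ≤ 1) : |lam x| ≤ ‖lam‖ := by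
  simpa using lam.le_of_opNorm_le_of_le le_rfl hx

theorem norm_le_of_isIntegralCurve (hγ : IsIntegralCurve γ fun _ => pendulum) {ρ : ℝ}
    (h0 : ‖γ 0‖ ≤ ρ) (t : ℝ) : ‖γ t‖ ≤ 6 * ρ + 3 := by
  have hρ : 0 ≤ ρ := (norm_nonneg _).trans h0
  have hle : ∀ x : TangentM, ‖x‖ ≤ 1 → γ 0 x ^ 2 ≤ ρ ^ 2 := fun x hx =>
    sq_le_sq.2 (((abs_apply_le_norm _ hx).trans h0).trans (le_abs_self ρ))
  have hx1 : h₁ (γ 0) ^ 2 ≤ ρ ^ 2 := hle _ (by simp [X₁, Prod.norm_def])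
  have hx2 : h₂ (γ 0) ^ 2 ≤ ρ ^ 2 := hle _ (by simp [X₂, Prod.norm_def])
  have hx3 : h₃ (γ 0) ^ 2 ≤ ρ ^ 2 := hle _ (by simp [X₃, Prod.norm_def])
  have hrad := h₁_sq_add_h₃_sq_eq hγ t
  have henergy := energy_eq_energy_zero hγ t
  rw [energy_eq, energy_eq] at henergy
  have h1 : |h₁ (γ t)| ≤ 2 * ρ :=
    abs_le_of_sq_le_sq (by nlinarith [sq_nonneg (h₃ (γ t))]) (by linarith)
  have h3 : |h₃ (γ t)| ≤ 2 * ρ :=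
    abs_le_of_sq_le_sq (by nlinarith [sq_nonneg (h₁ (γ t))]) (by linarith)
  have h2 : |h₂ (γ t)| ≤ 2 * ρ + 3 := by
    refine abs_le_of_sq_le_sq ?_ (by linarith)
    nlinarith [(abs_le.1 h1).1, (abs_le_of_sq_le_sq' hx1 hρ).2]
  linarith [norm_le_abs_h (γ t)]

end integralCurve

theorem hasDerivAt_tanh (u : ℝ) : HasDerivAt Real.tanh ((1 / Real.cosh u) ^ 2) u := by
  have htanh : Real.tanh = Real.sinh / Real.cosh := funext Real.tanh_eq_sinh_div_cosh
  rw [htanh]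
  refine ((Real.hasDerivAt_sinh u).div (Real.hasDerivAt_cosh u)
    (Real.cosh_pos u).ne').congr_deriv ?_
  rw [div_pow, one_pow, ← Real.cosh_sq_sub_sinh_sq u]
  ring

theorem hasDerivAt_one_div_cosh (u : ℝ) :
    HasDerivAt (fun u => 1 / Real.cosh u) (-(Real.tanh u * (1 / Real.cosh u))) u := by
  simp only [one_div]
  refine ((Real.hasDerivAt_cosh u).inv (Real.cosh_pos u).ne').congr_deriv ?_
  rw [Real.tanh_eq_sinh_div_cosh]
  have := Real.cosh_pos u
  field

theorem tanh_sq_add_one_div_cosh_sq (u : ℝ) : Real.tanh u ^ 2 + (1 / Real.cosh u) ^ 2 = 1 := by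
  have := Real.cosh_pos u
  rw [Real.tanh_eq_sinh_div_cosh, div_pow, div_pow, ← add_div, one_pow, ← Real.cosh_sq]
  exact div_self (by positivity)

theorem signType_coe_sq {s : SignType} (hs : s ≠ 0) : (s : ℝ) ^ 2 = 1 := by
  cases s <;> simp_all

theorem sqrt_two_mul_sq {p : ℝ} (hp : 0 < p) : √((2 * p) ^ 2) = 2 * p :=
  Real.sqrt_sq (by positivity)

/-! ### Oscillations -/

/-- The covector in `N₁` with `√r = 2p`, modulus `k` and `√r φ = u`. -/
noncomputable def oscState (k p u : ℝ) : N :=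
  ofHalfAngle ((2 * p) ^ 2) (k * sn u k) (dn u k) (k * (2 * p) * cn u k)

section oscState

variable {k : ℝ}

theorem mul_sn_sq_add_dn_sq (hk : |k| < 1) (u : ℝ) : (k * sn u k) ^ 2 + dn u k ^ 2 = 1 := by
  rw [dn_sq hk]
  ring

theorem isIntegralCurve_oscState (hk : |k| < 1) (p u : ℝ) :
    IsIntegralCurve (fun t => oscState k p (2 * p * t + u)) fun _ => pendulum :=
  isIntegralCurve_ofHalfAngle (mul_sn_sq_add_dn_sq hk)
    (fun u => (hasDerivAt_sn hk u).const_mul k) (hasDerivAt_dn hk)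
    (fun u => (hasDerivAt_cn hk u).const_mul (k * (2 * p)))
    (fun _ => by ring) (fun _ => by ring) (fun _ => by ring) u

theorem rad_oscState (hk : |k| < 1) (p u : ℝ) : rad (oscState k p u) = (2 * p) ^ 2 :=
  rad_ofHalfAngle (sq_nonneg _) (mul_sn_sq_add_dn_sq hk u)

theorem modulus_oscState (hk : k ∈ Ioo (0 : ℝ) 1) {p : ℝ} (hp : 0 < p) (u : ℝ) :
    modulus (oscState k p u) = k := by
  have hk1 : |k| < 1 := abs_lt_one_of_mem_Ioo hk
  rw [oscState, modulus_ofHalfAngle (by positivity) (mul_sn_sq_add_dn_sq hk1 u),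
    Real.sqrt_eq_iff_mul_self_eq (by positivity) hk.1.le]
  have hsq : (k * sn u k) ^ 2 + (k * (2 * p) * cn u k) ^ 2 / (2 * p) ^ 2 =
      k ^ 2 * (sn u k ^ 2 + cn u k ^ 2) := by field
  rw [hsq, sn_sq_add_cn_sq]
  ring

theorem oscState_mem_N₁ (hk : k ∈ Ioo (0 : ℝ) 1) {p : ℝ} (hp : 0 < p) (u : ℝ) :
    oscState k p u ∈ N₁ := by
  rw [mem_N₁_iff, modulus_oscState hk hp, rad_oscState (abs_lt_one_of_mem_Ioo hk)]
  exact ⟨by positivity, hk⟩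

theorem hasCoords₁_iff {lam : N} {τ p : ℝ} :
    HasCoords₁ lam τ p k ↔ 0 < p ∧ k ∈ Ioo (0 : ℝ) 1 ∧ lam = oscState k p (τ - p) := by
  constructor
  · rintro ⟨φ, r, ⟨hN, rfl, hk0, hk1, b, hb, hsin, hcos, hvel⟩, rfl, rfl⟩
    have hr := (mem_N₁_iff.1 hN).1
    have hk : |k| < 1 := abs_lt_one_of_mem_Ioo ⟨hk0, hk1⟩
    refine ⟨by positivity, ⟨hk0, hk1⟩, ?_⟩
    have hu : √(rad lam) * (φ + 1 / 2) - √(rad lam) / 2 = √(rad lam) * φ := by ring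
    rw [oscState, hu, mul_div_cancel₀ _ two_ne_zero, Real.sq_sqrt hr.le,
      eq_ofHalfAngle_iff hr (mul_sn_sq_add_dn_sq hk _)]
    exact ⟨rfl, b, hb, hsin, hcos, hvel⟩
  · rintro ⟨hp, hk, h⟩
    have hk1 : |k| < 1 := abs_lt_one_of_mem_Ioo hk
    have hN : lam ∈ N₁ := h ▸ oscState_mem_N₁ hk hp _
    obtain ⟨-, hb⟩ := (eq_ofHalfAngle_iff (by positivity) (mul_sn_sq_add_dn_sq hk1 _)).1 h
    refine ⟨(τ - p) / (2 * p), (2 * p) ^ 2, ⟨hN, ?_, hk.1, hk.2, ?_⟩, ?_, ?_⟩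
    · rw [h, rad_oscState hk1]
    · rwa [sqrt_two_mul_sq hp, mul_div_cancel₀ _ (by positivity)]
    · rw [sqrt_two_mul_sq hp]; ring
    · rw [sqrt_two_mul_sq hp]; field

theorem exists_eq_oscState {lam : N} (hr : 0 < rad lam) (h0 : 0 < modulus lam)
    (h1 : modulus lam < 1) : ∃ u, lam = oscState (modulus lam) (√(rad lam) / 2) u := by
  obtain ⟨A, B, hAB, hB, hlam⟩ := exists_eq_ofHalfAngle lam
  have hmod : modulus lam ^ 2 = A ^ 2 + (vel lam / 2) ^ 2 / rad lam := by
    conv_lhs => rw [hlam, modulus_ofHalfAngle hr hAB]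
    exact Real.sq_sqrt (by positivity)
  set κ := modulus lam
  have hκ : |κ| < 1 := abs_lt_one_of_mem_Ioo ⟨h0, h1⟩
  obtain ⟨u, hsn, hcn⟩ := exists_sn_cn_eq hκ (x := A / κ) (y := vel lam / 2 / (κ * √(rad lam))) (by
    rw [div_pow, div_pow, mul_pow, Real.sq_sqrt hr.le]
    field_simp at hmod ⊢
    linarith)
  have hdn : dn u κ = B := by
    refine (sq_eq_sq₀ (dn_pos hκ u).le hB).1 ?_
    rw [dn_sq hκ, hsn]
    field_simp
    linarith
  refine ⟨u, hlam.trans ?_⟩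
  rw [oscState, hsn, hcn, hdn, mul_div_cancel₀ _ two_ne_zero, Real.sq_sqrt hr.le,
    mul_div_cancel₀ _ h0.ne', mul_div_cancel₀ _ (by positivity)]

end oscState

/-! ### Rotations -/

/-- The covector in `N₂^±`, `s = ±1`, with `√r = 2kp`, modulus `k` and `√r φ / k = u`. -/
noncomputable def rotState (s : SignType) (k p u : ℝ) : N :=
  ofHalfAngle ((2 * k * p) ^ 2) (s * sn u k) (cn u k) (s * (2 * p) * dn u k)

section rotState

variable {s : SignType} {k : ℝ}

theorem sign_mul_sn_sq_add_cn_sq (hs : s ≠ 0) (u k : ℝ) : (s * sn u k) ^ 2 + cn u k ^ 2 = 1 := by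
  rw [mul_pow, signType_coe_sq hs, one_mul, sn_sq_add_cn_sq]

theorem isIntegralCurve_rotState (hs : s ≠ 0) (hk : |k| < 1) (p u : ℝ) :
    IsIntegralCurve (fun t => rotState s k p (2 * p * t + u)) fun _ => pendulum :=
  isIntegralCurve_ofHalfAngle (sign_mul_sn_sq_add_cn_sq hs · k)
    (fun u => (hasDerivAt_sn hk u).const_mul (s : ℝ)) (hasDerivAt_cn hk)
    (fun u => (hasDerivAt_dn hk u).const_mul (s * (2 * p) : ℝ)) (fun _ => by ring)
    (fun u => by linear_combination (2 * p * dn u k * sn u k) * signType_coe_sq hs)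
    (fun _ => by ring) u

theorem rad_rotState (hs : s ≠ 0) (k p u : ℝ) : rad (rotState s k p u) = (2 * k * p) ^ 2 :=
  rad_ofHalfAngle (sq_nonneg _) (sign_mul_sn_sq_add_cn_sq hs u k)

theorem modulus_rotState (hs : s ≠ 0) (hk : k ∈ Ioo (0 : ℝ) 1) {p : ℝ} (hp : 0 < p) (u : ℝ) :
    modulus (rotState s k p u) = k⁻¹ := by
  have hk0 := hk.1
  rw [rotState, modulus_ofHalfAngle (by positivity) (sign_mul_sn_sq_add_cn_sq hs u k),
    Real.sqrt_eq_iff_mul_self_eq (by positivity) (by positivity), mul_pow, mul_pow, mul_pow,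
    signType_coe_sq hs, dn_sq (abs_lt_one_of_mem_Ioo hk)]
  field

theorem sign_vel_rotState (hk : |k| < 1) {p : ℝ} (hp : 0 < p) (u : ℝ) :
    SignType.sign (vel (rotState s k p u)) = s := by
  have hdn := dn_pos hk u
  rw [vel, rotState, h₂_ofHalfAngle]
  cases s <;> simp [hp, hdn]

theorem rotState_mem_N₂s (hs : s ≠ 0) (hk : k ∈ Ioo (0 : ℝ) 1) {p : ℝ} (hp : 0 < p) (u : ℝ) :
    rotState s k p u ∈ N₂s s := by
  have hk0 := hk.1
  refine ⟨?_, sign_vel_rotState (abs_lt_one_of_mem_Ioo hk) hp u⟩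
  rw [mem_N₂_iff, modulus_rotState hs hk hp, rad_rotState hs]
  exact ⟨by positivity, one_lt_inv_iff₀.2 hk⟩

theorem hasCoords₂_iff (hs : s ≠ 0) {lam : N} {τ p : ℝ} :
    HasCoords₂ s lam τ p k ↔ 0 < p ∧ k ∈ Ioo (0 : ℝ) 1 ∧ lam = rotState s k p (τ - p) := by
  constructor
  · rintro ⟨φ, r, ⟨hN, rfl, hk0, hk1, b, hb, hsin, hcos, hvel⟩, rfl, rfl⟩
    have hr := (mem_N₂_iff.1 hN.1).1
    refine ⟨by positivity, ⟨hk0, hk1⟩, ?_⟩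
    have hu : √(rad lam) / k * (φ + 1 / 2) - √(rad lam) / (2 * k) = √(rad lam) * φ / k := by field
    have h2p : 2 * (√(rad lam) / (2 * k)) = √(rad lam) / k := by field
    rw [rotState, hu, mul_div_cancel₀ _ (by positivity), Real.sq_sqrt hr.le, h2p,
      eq_ofHalfAngle_iff hr (sign_mul_sn_sq_add_cn_sq hs _ k)]
    exact ⟨rfl, b, hb, hsin, hcos, hvel⟩
  · rintro ⟨hp, hk, h⟩
    have hk0 := hk.1
    have hN : lam ∈ N₂s s := h ▸ rotState_mem_N₂s hs hk hp _
    obtain ⟨-, hb⟩ := (eq_ofHalfAngle_iff (by positivity) (sign_mul_sn_sq_add_cn_sq hs _ k)).1 h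
    have hsqrt : √((2 * k * p) ^ 2) = k * (2 * p) := by
      rw [Real.sqrt_sq (by positivity)]; ring
    refine ⟨(τ - p) / (2 * p), (2 * k * p) ^ 2, ⟨hN, ?_, hk.1, hk.2, ?_⟩, ?_, ?_⟩
    · rw [h, rad_rotState hs]
    · have hu : k * (2 * p) * ((τ - p) / (2 * p)) / k = τ - p := by field
      rwa [hsqrt, hu, mul_div_cancel_left₀ _ hk0.ne']
    · rw [hsqrt]; field
    · rw [hsqrt]; field

theorem exists_eq_rotState {lam : N} (hr : 0 < rad lam) (h1 : 1 < modulus lam) :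
    ∃ s ≠ 0, ∃ u, 0 ≤ cn u (modulus lam)⁻¹ ∧
      lam = rotState s (modulus lam)⁻¹ (modulus lam * (√(rad lam) / 2)) u := by
  obtain ⟨A, B, hAB, hB, hlam⟩ := exists_eq_ofHalfAngle lam
  have hmod : modulus lam ^ 2 = A ^ 2 + (vel lam / 2) ^ 2 / rad lam := by
    conv_lhs => rw [hlam, modulus_ofHalfAngle hr hAB]
    exact Real.sq_sqrt (by positivity)
  set κ := modulus lam
  have hκ := abs_inv_lt_one h1
  have hκ0 : 0 < κ := one_pos.trans h1
  have hvel : vel lam / 2 ≠ 0 := fun h => by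
    rw [h, zero_pow two_ne_zero, zero_div] at hmod
    nlinarith [sq_nonneg B]
  have hs : SignType.sign (vel lam / 2) ≠ 0 := sign_ne_zero.2 hvel
  obtain ⟨u, hsn, hcn⟩ := exists_sn_cn_eq hκ (x := SignType.sign (vel lam / 2) * A) (y := B) (by
    rw [mul_pow, signType_coe_sq hs, one_mul, hAB])
  have hdn : dn u κ⁻¹ = |vel lam / 2| / (κ * √(rad lam)) := by
    refine (sq_eq_sq₀ (dn_pos hκ u).le (by positivity)).1 ?_
    rw [dn_sq hκ, hsn, div_pow, mul_pow, mul_pow, signType_coe_sq hs, Real.sq_sqrt hr.le, sq_abs]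
    field_simp at hmod ⊢
    linarith
  refine ⟨_, hs, u, hcn ▸ hB, hlam.trans ?_⟩
  have hsqrt : 2 * κ⁻¹ * (κ * (√(rad lam) / 2)) = √(rad lam) := by field
  rw [rotState, hsqrt, Real.sq_sqrt hr.le, hsn, hcn, hdn, ← mul_assoc, ← sq, signType_coe_sq hs,
    one_mul]
  congr 1
  conv_lhs => rw [← sign_mul_abs (vel lam / 2)]
  field

end rotState

/-! ### Separatrix motions -/

/-- The covector in `N₃^±`, `s = ±1`, with `√r = 2p` and `√r φ = u`. -/
noncomputable def sepState (s : SignType) (p u : ℝ) : N :=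
  ofHalfAngle ((2 * p) ^ 2) (s * Real.tanh u) (1 / Real.cosh u) (s * (2 * p) * (1 / Real.cosh u))

section sepState

variable {s : SignType}

theorem sign_mul_tanh_sq_add_one_div_cosh_sq (hs : s ≠ 0) (u : ℝ) :
    (s * Real.tanh u) ^ 2 + (1 / Real.cosh u) ^ 2 = 1 := by
  rw [mul_pow, signType_coe_sq hs, one_mul, tanh_sq_add_one_div_cosh_sq]

theorem isIntegralCurve_sepState (hs : s ≠ 0) (p u : ℝ) :
    IsIntegralCurve (fun t => sepState s p (2 * p * t + u)) fun _ => pendulum :=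
  isIntegralCurve_ofHalfAngle (sign_mul_tanh_sq_add_one_div_cosh_sq hs)
    (fun u => (hasDerivAt_tanh u).const_mul (s : ℝ)) hasDerivAt_one_div_cosh
    (fun u => (hasDerivAt_one_div_cosh u).const_mul (s * (2 * p) : ℝ)) (fun _ => by ring)
    (fun u => by
      linear_combination (2 * p * Real.tanh u * (1 / Real.cosh u)) * signType_coe_sq hs)
    (fun _ => by ring) u

theorem rad_sepState (hs : s ≠ 0) (p u : ℝ) : rad (sepState s p u) = (2 * p) ^ 2 :=
  rad_ofHalfAngle (sq_nonneg _) (sign_mul_tanh_sq_add_one_div_cosh_sq hs u)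

theorem modulus_sepState (hs : s ≠ 0) {p : ℝ} (hp : 0 < p) (u : ℝ) :
    modulus (sepState s p u) = 1 := by
  have hsq : (s * (2 * p) * (1 / Real.cosh u)) ^ 2 / (2 * p) ^ 2 = (1 / Real.cosh u) ^ 2 := by
    rw [mul_pow, mul_pow, signType_coe_sq hs]
    field
  rw [sepState, modulus_ofHalfAngle (by positivity) (sign_mul_tanh_sq_add_one_div_cosh_sq hs u),
    hsq, sign_mul_tanh_sq_add_one_div_cosh_sq hs, Real.sqrt_one]

theorem sign_vel_sepState {p : ℝ} (hp : 0 < p) (u : ℝ) :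
    SignType.sign (vel (sepState s p u)) = s := by
  have hcosh := Real.cosh_pos u
  rw [vel, sepState, h₂_ofHalfAngle]
  cases s <;> simp [hp, hcosh]

theorem sepState_mem_N₃s (hs : s ≠ 0) {p : ℝ} (hp : 0 < p) (u : ℝ) : sepState s p u ∈ N₃s s := by
  refine ⟨?_, sign_vel_sepState hp u⟩
  rw [mem_N₃_iff, modulus_sepState hs hp, rad_sepState hs]
  exact ⟨by positivity, rfl, beta_ofHalfAngle_ne_pi (by positivity)
    (sign_mul_tanh_sq_add_one_div_cosh_sq hs u) (one_div_pos.2 (Real.cosh_pos u)).ne'⟩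

theorem hasCoords₃_iff (hs : s ≠ 0) {lam : N} {τ p : ℝ} :
    HasCoords₃ s lam τ p ↔ 0 < p ∧ lam = sepState s p (τ - p) := by
  constructor
  · rintro ⟨φ, r, ⟨hN, rfl, b, hb, hsin, hcos, hvel⟩, rfl, rfl⟩
    have hr := (mem_N₃_iff.1 hN.1).1
    refine ⟨by positivity, ?_⟩
    have hu : √(rad lam) * (φ + 1 / 2) - √(rad lam) / 2 = √(rad lam) * φ := by ring
    rw [sepState, hu, mul_div_cancel₀ _ two_ne_zero, Real.sq_sqrt hr.le,
      eq_ofHalfAngle_iff hr (sign_mul_tanh_sq_add_one_div_cosh_sq hs _)]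
    exact ⟨rfl, b, hb, hsin, hcos, hvel⟩
  · rintro ⟨hp, h⟩
    have hN : lam ∈ N₃s s := h ▸ sepState_mem_N₃s hs hp _
    obtain ⟨-, hb⟩ := (eq_ofHalfAngle_iff (by positivity)
      (sign_mul_tanh_sq_add_one_div_cosh_sq hs _)).1 h
    refine ⟨(τ - p) / (2 * p), (2 * p) ^ 2, ⟨hN, ?_, ?_⟩, ?_, ?_⟩
    · rw [h, rad_sepState hs]
    · rwa [sqrt_two_mul_sq hp, mul_div_cancel₀ _ (by positivity)]
    · rw [sqrt_two_mul_sq hp]; ring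
    · rw [sqrt_two_mul_sq hp]; field

theorem exists_tanh_one_div_cosh_eq {x y : ℝ} (h : x ^ 2 + y ^ 2 = 1) (hy : 0 < y) :
    ∃ u, Real.tanh u = x ∧ 1 / Real.cosh u = y := by
  have hcosh : Real.cosh (Real.arsinh (x / y)) = 1 / y := by
    rw [Real.cosh_arsinh, Real.sqrt_eq_iff_mul_self_eq (by positivity) (by positivity)]
    field_simp
    linarith
  refine ⟨Real.arsinh (x / y), ?_, by rw [hcosh, one_div_one_div]⟩
  rw [Real.tanh_eq_sinh_div_cosh, hcosh, Real.sinh_arsinh]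
  field

theorem exists_eq_sepState {lam : N} (hr : 0 < rad lam) (h1 : modulus lam = 1)
    (h2 : vel lam ≠ 0) : ∃ s ≠ 0, ∃ u, lam = sepState s (√(rad lam) / 2) u := by
  obtain ⟨A, B, hAB, hB, hlam⟩ := exists_eq_ofHalfAngle lam
  have hvel : vel lam / 2 ≠ 0 := div_ne_zero h2 two_ne_zero
  have hmod : 1 ^ 2 = A ^ 2 + (vel lam / 2) ^ 2 / rad lam := by
    rw [← h1]
    conv_lhs => rw [hlam, modulus_ofHalfAngle hr hAB]
    exact Real.sq_sqrt (by positivity)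
  have habs : |vel lam / 2| = √(rad lam) * B := by
    refine (sq_eq_sq₀ (abs_nonneg _) (by positivity)).1 ?_
    rw [sq_abs, mul_pow, Real.sq_sqrt hr.le]
    field_simp at hmod ⊢
    linear_combination -(rad lam * 4) * hAB - hmod
  have hB0 : B ≠ 0 := by
    rintro rfl
    exact hvel (by simpa using habs)
  have hs : SignType.sign (vel lam / 2) ≠ 0 := sign_ne_zero.2 hvel
  obtain ⟨u, htanh, hcosh⟩ := exists_tanh_one_div_cosh_eq
    (x := SignType.sign (vel lam / 2) * A) (y := B)
    (by rw [mul_pow, signType_coe_sq hs, one_mul, hAB]) (hB.lt_of_ne' hB0)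
  refine ⟨_, hs, u, hlam.trans ?_⟩
  rw [sepState, mul_div_cancel₀ _ two_ne_zero, Real.sq_sqrt hr.le, htanh, hcosh, ← mul_assoc,
    ← sq, signType_coe_sq hs, one_mul, mul_assoc, ← habs, sign_mul_abs]

end sepState

theorem modulus_pos {lam : N} (hr : 0 < rad lam) (h : h₃ lam ≠ 0 ∨ vel lam ≠ 0) :
    0 < modulus lam := by
  obtain ⟨A, B, hAB, -, hlam⟩ := exists_eq_ofHalfAngle lam
  rw [hlam, modulus_ofHalfAngle hr hAB, Real.sqrt_pos]
  rcases h with h3 | h2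
  · have hA : A ≠ 0 := by
      rintro rfl
      exact h3 (by rw [hlam, h₃_ofHalfAngle]; simp)
    positivity
  · positivity

theorem vel_ne_zero_of_modulus_eq_one {lam : N} (hr : 0 < rad lam) (h1 : modulus lam = 1)
    (h3 : h₃ lam ≠ 0) : vel lam ≠ 0 := by
  intro h2
  obtain ⟨A, B, hAB, -, hlam⟩ := exists_eq_ofHalfAngle lam
  rw [h2, zero_div] at hlam
  rw [hlam, modulus_ofHalfAngle hr hAB, Real.sqrt_eq_one, zero_pow two_ne_zero, zero_div,
    add_zero] at h1
  have hB : B = 0 := pow_eq_zero_iff two_ne_zero |>.1 (by linarith)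
  exact h3 (by rw [hlam, h₃_ofHalfAngle, hB]; ring)

theorem exists_isIntegralCurve_pendulum (lam : N) :
    ∃ γ, IsIntegralCurve γ (fun _ => pendulum) ∧ γ 0 = lam := by
  have hconst (h : pendulum lam = 0) : ∃ γ, IsIntegralCurve γ (fun _ => pendulum) ∧ γ 0 = lam :=
    ⟨fun _ => lam, isIntegralCurve_const fun _ => h, rfl⟩
  rcases (rad_nonneg lam).eq_or_lt' with hr | hr
  · exact hconst (pendulum_eq_zero_of_rad_eq_zero hr)
  by_cases heq : h₃ lam = 0 ∧ vel lam = 0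
  · exact hconst (pendulum_eq_zero_of_h₃_eq_zero heq.1 heq.2)
  have hmov : h₃ lam ≠ 0 ∨ vel lam ≠ 0 := by tauto
  have hκ := modulus_pos hr hmov
  rcases lt_trichotomy (modulus lam) 1 with h | h | h
  · obtain ⟨u, hu⟩ := exists_eq_oscState hr hκ h
    exact ⟨_, isIntegralCurve_oscState (abs_lt_one_of_mem_Ioo ⟨hκ, h⟩) _ u, by simpa using hu.symm⟩
  · have hvel : vel lam ≠ 0 := hmov.elim (vel_ne_zero_of_modulus_eq_one hr h) id
    obtain ⟨s, hs, u, hu⟩ := exists_eq_sepState hr h hvel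
    exact ⟨_, isIntegralCurve_sepState hs _ u, by simpa using hu.symm⟩
  · obtain ⟨s, hs, u, -, hu⟩ := exists_eq_rotState hr h
    exact ⟨_, isIntegralCurve_rotState hs (abs_inv_lt_one h) _ u, by simpa using hu.symm⟩

theorem exists_pendulum_flow :
    ∃ Φ : Flow ℝ N, ∀ γ, IsIntegralCurve γ (fun _ => pendulum) → ∀ t, Φ t (γ 0) = γ t :=
  have : ProperSpace N := FiniteDimensional.proper ℝ N
  exists_flow_of_exists_isIntegralCurve contDiff_pendulum
    (fun ρ => ⟨6 * ρ + 3, fun _ hγ => norm_le_of_isIntegralCurve hγ⟩)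
    exists_isIntegralCurve_pendulum

/-- The homeomorphism taking `λ` to the state at time `1 / 2` of the pendulum started at `λ`, that
is, at the midpoint of the elastica. In the coordinates `(τ, p, k)` it takes the phase `τ - p`
to `τ`. -/
noncomputable def midpoint : N ≃ₜ N := exists_pendulum_flow.choose.toHomeomorph (1 / 2)

theorem midpoint_eq {γ : ℝ → N} (hγ : IsIntegralCurve γ fun _ => pendulum) :
    midpoint (γ 0) = γ (1 / 2) :=
  exists_pendulum_flow.choose_spec γ hγ _

section midpoint

variable {s : SignType} {k : ℝ}

theorem midpoint_oscState (hk : |k| < 1) (p τ : ℝ) :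
    midpoint (oscState k p (τ - p)) = oscState k p τ := by
  convert midpoint_eq (isIntegralCurve_oscState hk p (τ - p)) using 2 <;> ring_nf

theorem midpoint_rotState (hs : s ≠ 0) (hk : |k| < 1) (p τ : ℝ) :
    midpoint (rotState s k p (τ - p)) = rotState s k p τ := by
  convert midpoint_eq (isIntegralCurve_rotState hs hk p (τ - p)) using 2 <;> ring_nf

theorem midpoint_sepState (hs : s ≠ 0) (p τ : ℝ) :
    midpoint (sepState s p (τ - p)) = sepState s p τ := by
  convert midpoint_eq (isIntegralCurve_sepState hs p (τ - p)) using 2 <;> ring_nf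

theorem mem_block₁_iff {lam : N} {a b : ℝ} : lam ∈ block₁ a b ↔
    ∃ τ p k : ℝ, midpoint lam = oscState k p τ ∧ τ ∈ Ioo (a * ellK k) (b * ellK k) ∧
      p ∈ Ioo 0 (p₁ k) ∧ k ∈ Ioo (0 : ℝ) 1 := by
  refine exists₃_congr fun τ p k => ?_
  rw [hasCoords₁_iff, and_assoc, and_assoc]
  constructor
  · rintro ⟨-, hk, rfl, h⟩
    exact ⟨midpoint_oscState (abs_lt_one_of_mem_Ioo hk) p τ, h⟩
  · rintro ⟨hlam, h⟩
    have hk := h.2.2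
    rw [← midpoint_oscState (abs_lt_one_of_mem_Ioo hk), midpoint.injective.eq_iff] at hlam
    exact ⟨h.2.1.1, hk, hlam, h⟩

theorem mem_block₂_iff (hs : s ≠ 0) {lam : N} {a b : ℝ} : lam ∈ block₂ s a b ↔
    ∃ τ p k : ℝ, midpoint lam = rotState s k p τ ∧ τ ∈ Ioo (a * ellK k) (b * ellK k) ∧
      p ∈ Ioo 0 (ellK k) ∧ k ∈ Ioo (0 : ℝ) 1 := by
  refine exists₃_congr fun τ p k => ?_
  rw [hasCoords₂_iff hs, and_assoc, and_assoc]
  constructor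
  · rintro ⟨-, hk, rfl, h⟩
    exact ⟨midpoint_rotState hs (abs_lt_one_of_mem_Ioo hk) p τ, h⟩
  · rintro ⟨hlam, h⟩
    have hk := h.2.2
    rw [← midpoint_rotState hs (abs_lt_one_of_mem_Ioo hk),
      midpoint.injective.eq_iff] at hlam
    exact ⟨h.2.1.1, hk, hlam, h⟩

theorem mem_block₃_iff (hs : s ≠ 0) {lam : N} {I : Set ℝ} : lam ∈ block₃ s I ↔
    ∃ τ p : ℝ, midpoint lam = sepState s p τ ∧ τ ∈ I ∧ p ∈ Ioi (0 : ℝ) := by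
  refine exists₂_congr fun τ p => ?_
  rw [hasCoords₃_iff hs, and_assoc]
  constructor
  · rintro ⟨-, rfl, h⟩
    exact ⟨midpoint_sepState hs p τ, h⟩
  · rintro ⟨hlam, h⟩
    rw [← midpoint_sepState hs, midpoint.injective.eq_iff] at hlam
    exact ⟨h.2, hlam, h⟩

end midpoint

/-! ### The regions of admissible midpoints -/

/-- The midpoint states of the elasticae from one domain `Lⱼ`: the signs of `h₃` and `h₂`, given by
those of `ε` and `δ`, single out `j`. -/
def region (ε δ : ℝ) : Set N :=
  {lam | 0 < ε * h₃ lam ∧ 0 < δ * h₂ lam ∧ (modulus lam, √(rad lam) / 2) ∈ stableParams}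

theorem continuous_h₁ : Continuous h₁ := by
  unfold h₁
  fun_prop

theorem continuous_h₂ : Continuous h₂ := by
  unfold h₂
  fun_prop

theorem continuous_h₃ : Continuous h₃ := by
  unfold h₃
  fun_prop

theorem continuous_rad : Continuous rad :=
  ((continuous_h₁.pow 2).add (continuous_h₃.pow 2)).sqrt

theorem continuousAt_modulus {lam : N} (hr : 0 < rad lam) : ContinuousAt modulus lam := by
  have henergy : Continuous energy :=
    (((continuous_h₂.pow 2).div_const 2).add continuous_h₁).congr fun lam => (energy_eq lam).symm
  exact ((henergy.add continuous_rad).continuousAt.div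
    (continuous_const.mul continuous_rad).continuousAt (mul_pos two_pos hr).ne').sqrt

theorem rad_pos_of_h₃_ne_zero {lam : N} (h : h₃ lam ≠ 0) : 0 < rad lam :=
  Real.sqrt_pos.2 (add_pos_of_nonneg_of_pos (sq_nonneg _) (sq_pos_of_ne_zero h))

variable {ε δ : ℝ} {lam : N}

theorem h₃_ne_zero_of_mem_region (h : lam ∈ region ε δ) : h₃ lam ≠ 0 :=
  right_ne_zero_of_mul h.1.ne'

theorem isOpen_region (ε δ : ℝ) : IsOpen (region ε δ) := by
  refine isOpen_iff_mem_nhds.2 fun lam h => ?_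
  have hr := rad_pos_of_h₃_ne_zero (h₃_ne_zero_of_mem_region h)
  have hparams : ContinuousAt (fun lam => (modulus lam, √(rad lam) / 2)) lam :=
    (continuousAt_modulus hr).prodMk (continuous_rad.sqrt.div_const 2).continuousAt
  filter_upwards [(continuous_h₃.const_mul ε).continuousAt.eventually_const_lt h.1,
    (continuous_h₂.const_mul δ).continuousAt.eventually_const_lt h.2.1,
    hparams.preimage_mem_nhds (isOpen_stableParams.mem_nhds h.2.2)] with lam h3 h2 hlam
  exact ⟨h3, h2, hlam⟩

/-- The dilation `(r, β, c) ↦ (s² r, β, s c)`, which preserves `κ` and multiplies `p` by `s`. -/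
noncomputable def dilate (s : ℝ) (lam : N) : N :=
  covector (s ^ 2 * h₁ lam) (s ^ 2 * h₃ lam) (s * h₂ lam)

theorem continuous_dilate (lam : N) : Continuous fun s => dilate s lam := by
  unfold dilate covector
  fun_prop

theorem dilate_zero (lam : N) : dilate 0 lam = 0 := by simp [dilate, covector]

theorem dilate_one (lam : N) : dilate 1 lam = lam := by simp [dilate]

theorem rad_dilate (s : ℝ) (lam : N) : rad (dilate s lam) = s ^ 2 * rad lam := by
  rw [rad, dilate, h₁_covector, h₃_covector, mul_pow, mul_pow, ← mul_add,
    Real.sqrt_mul (by positivity), Real.sqrt_sq (sq_nonneg s), ← rad]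

theorem modulus_dilate {s : ℝ} (hs : s ≠ 0) (lam : N) : modulus (dilate s lam) = modulus lam := by
  have henergy : energy (dilate s lam) = s ^ 2 * energy lam := by
    rw [energy_eq, energy_eq, dilate, h₁_covector, h₂_covector]
    ring
  rw [modulus, modulus, henergy, rad_dilate, ← mul_add, mul_left_comm 2,
    mul_div_mul_left _ _ (pow_ne_zero 2 hs)]

theorem dilate_mem_region (h : lam ∈ region ε δ) {s : ℝ} (hs : s ∈ Ioc (0 : ℝ) 1) :
    dilate s lam ∈ region ε δ := by
  have hs0 := hs.1
  refine ⟨?_, ?_, ?_⟩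
  · rw [dilate, h₃_covector, mul_left_comm]
    exact mul_pos (by positivity) h.1
  · rw [dilate, h₂_covector, mul_left_comm]
    exact mul_pos hs0 h.2.1
  · rw [modulus_dilate hs0.ne', rad_dilate, Real.sqrt_mul (sq_nonneg s), Real.sqrt_sq hs0.le]
    refine mem_stableParams_of_le h.2.2 ?_
    gcongr
    exact mul_le_of_le_one_left (Real.sqrt_nonneg _) hs.2

theorem exists_norm_dilate_lt_one (lam : N) : ∃ s ∈ Ioc (0 : ℝ) 1, ‖dilate s lam‖ < 1 := by
  have hsmall : ∀ᶠ s in 𝓝 0, ‖dilate s lam‖ < 1 :=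
    (continuous_dilate lam).norm.continuousAt.eventually_lt_const (by simp [dilate_zero])
  obtain ⟨s, hs, hs01⟩ :=
    ((hsmall.filter_mono nhdsWithin_le_nhds).and (Ioc_mem_nhdsGT (zero_lt_one (α := ℝ)))).exists
  exact ⟨s, hs01, hs⟩

theorem mem_region_of_norm_lt_one (h3 : 0 < ε * h₃ lam) (h2 : 0 < δ * h₂ lam)
    (hlam : ‖lam‖ < 1) : lam ∈ region ε δ := by
  have hh₃ : h₃ lam ≠ 0 := right_ne_zero_of_mul h3.ne'
  have hr := rad_pos_of_h₃_ne_zero hh₃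
  have hκ := modulus_pos hr (Or.inl hh₃)
  have hle : ∀ x : TangentM, ‖x‖ ≤ 1 → |lam x| ≤ 1 := fun x hx =>
    (abs_apply_le_norm lam hx).trans hlam.le
  have hx1 : |h₁ lam| ≤ 1 := hle _ (by simp [X₁, Prod.norm_def])
  have hx2 : |h₂ lam| ≤ 1 := hle _ (by simp [X₂, Prod.norm_def])
  have hx3 : |h₃ lam| ≤ 1 := hle _ (by simp [X₃, Prod.norm_def])
  have hrad : rad lam ≤ 2 := by
    refine Real.sqrt_le_iff.2 ⟨zero_le_two, ?_⟩
    linarith [(sq_le_one_iff_abs_le_one _).2 hx1, (sq_le_one_iff_abs_le_one _).2 hx3]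
  have henergy : energy lam ≤ 2 := by
    rw [energy_eq]
    linarith [(sq_le_one_iff_abs_le_one _).2 hx2, (abs_le.1 hx1).2]
  have hmul : modulus lam * √(rad lam) = √((energy lam + rad lam) / 2) := by
    rw [modulus, ← Real.sqrt_mul' _ hr.le]
    congr 1
    field
  have hsqrt : ∀ {x : ℝ}, x ≤ 2 → √x / 2 ≤ 1 := fun hx => by
    rw [div_le_one two_pos]
    exact Real.sqrt_le_iff.2 ⟨zero_le_two, by linarith⟩
  refine ⟨h3, h2, mem_stableParams_of_le_one hκ (hsqrt hrad) ?_⟩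
  rw [← mul_div_assoc, hmul]
  exact hsqrt (by linarith)

theorem joinedIn_region_dilate (h : lam ∈ region ε δ) {s : ℝ} (hs : s ∈ Ioc (0 : ℝ) 1) :
    JoinedIn (region ε δ) (dilate s lam) lam := by
  have himage : IsPathConnected ((dilate · lam) '' Icc s 1) :=
    ((convex_Icc s 1).isPathConnected (nonempty_Icc.2 hs.2)).image (continuous_dilate lam)
  have hjoined := himage.joinedIn _ (mem_image_of_mem _ (left_mem_Icc.2 hs.2)) _
    (mem_image_of_mem _ (right_mem_Icc.2 hs.2))
  simp only [dilate_one] at hjoined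
  exact hjoined.mono (image_subset_iff.2 fun t ht =>
    dilate_mem_region h ⟨hs.1.trans_le ht.1, ht.2⟩)

theorem convex_orthant_inter_ball (ε δ : ℝ) :
    Convex ℝ {lam : N | 0 < ε * h₃ lam ∧ 0 < δ * h₂ lam ∧ ‖lam‖ < 1} := by
  have hball : Convex ℝ {lam : N | ‖lam‖ < 1} := by
    simpa only [Metric.ball, dist_zero_right] using convex_ball (0 : N) 1
  have h3 : IsLinearMap ℝ fun lam : N => ε * h₃ lam :=
    ⟨fun _ _ => by simp [h₃, mul_add], fun _ _ => by simp [h₃, mul_left_comm]⟩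
  have h2 : IsLinearMap ℝ fun lam : N => δ * h₂ lam :=
    ⟨fun _ _ => by simp [h₂, mul_add], fun _ _ => by simp [h₂, mul_left_comm]⟩
  exact (convex_halfSpace_gt h3 0).inter ((convex_halfSpace_gt h2 0).inter hball)

theorem isPathConnected_region (hε : ε ≠ 0) (hδ : δ ≠ 0) : IsPathConnected (region ε δ) := by
  set S := {lam : N | 0 < ε * h₃ lam ∧ 0 < δ * h₂ lam ∧ ‖lam‖ < 1}
  have hS : S ⊆ region ε δ := fun lam h => mem_region_of_norm_lt_one h.1 h.2.1 h.2.2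
  have hne : S.Nonempty := by
    obtain ⟨s, hs, hnorm⟩ := exists_norm_dilate_lt_one (covector 0 ε δ)
    have hs0 := hs.1
    refine ⟨_, ?_, ?_, hnorm⟩
    · rw [dilate, h₃_covector, h₃_covector, mul_left_comm]
      exact mul_pos (by positivity) (mul_self_pos.2 hε)
    · rw [dilate, h₂_covector, h₂_covector, mul_left_comm]
      exact mul_pos hs0 (mul_self_pos.2 hδ)
  obtain ⟨x, hx, hjoin⟩ := (convex_orthant_inter_ball ε δ).isPathConnected hne
  refine ⟨x, hS hx, fun {lam} h => ?_⟩
  obtain ⟨s, hs, hnorm⟩ := exists_norm_dilate_lt_one lam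
  have hmem := dilate_mem_region h hs
  exact ((hjoin ⟨hmem.1, hmem.2.1, hnorm⟩).mono hS).trans (joinedIn_region_dilate h hs)

/-! ### The domains as preimages of regions -/

/-- The `n`-th quadrant `(n π / 2, (n + 1) π / 2)` consists, modulo `2π`, of the angles whose sine
has the sign of `σ` and whose cosine has the sign of `χ`. -/
def IsQuadrant (n : ℤ) (σ χ : ℝ) : Prop :=
  ∀ ψ, (∃ θ ∈ Ioo (n * (Real.pi / 2)) ((n + 1) * (Real.pi / 2)),
    Real.sin θ = Real.sin ψ ∧ Real.cos θ = Real.cos ψ) ↔ 0 < σ * Real.sin ψ ∧ 0 < χ * Real.cos ψ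

theorem isQuadrant_neg_one : IsQuadrant (-1) (-1) 1 := by
  have hleft : ((-1 : ℤ) : ℝ) * (Real.pi / 2) = -(Real.pi / 2) := by simp
  have hright : (((-1 : ℤ) : ℝ) + 1) * (Real.pi / 2) = 0 := by simp
  intro ψ
  rw [hleft, hright, one_mul, neg_one_mul, neg_pos]
  constructor
  · rintro ⟨θ, hθ, hsin, hcos⟩
    rw [← hsin, ← hcos]
    exact ⟨Real.sin_neg_of_neg_of_neg_pi_lt hθ.2 (by linarith [hθ.1, Real.pi_pos]),
      Real.cos_pos_of_mem_Ioo ⟨hθ.1, by linarith [hθ.2, Real.pi_pos]⟩⟩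
  · rintro ⟨hsin, hcos⟩
    have hlt : -1 < Real.sin ψ := by nlinarith [Real.sin_sq_add_cos_sq ψ]
    refine ⟨Real.arcsin (Real.sin ψ), ⟨Real.neg_pi_div_two_lt_arcsin.2 hlt,
      Real.arcsin_lt_zero.2 hsin⟩, Real.sin_arcsin hlt.le (Real.sin_le_one ψ), ?_⟩
    rw [Real.cos_arcsin, ← Real.cos_sq', Real.sqrt_sq hcos.le]

theorem IsQuadrant.add_one {n : ℤ} {σ χ : ℝ} (h : IsQuadrant n σ χ) :
    IsQuadrant (n + 1) χ (-σ) := by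
  intro ψ
  have hrotate := h (ψ - Real.pi / 2)
  rw [Real.sin_sub_pi_div_two, Real.cos_sub_pi_div_two, mul_neg, ← neg_mul, and_comm (a := 0 < _)]
    at hrotate
  rw [← hrotate]
  push_cast
  constructor
  · rintro ⟨θ, hθ, hsin, hcos⟩
    refine ⟨θ - Real.pi / 2, ⟨by linarith [hθ.1], by linarith [hθ.2]⟩, ?_, ?_⟩
    · rw [Real.sin_sub_pi_div_two, hcos]
    · rw [Real.cos_sub_pi_div_two, hsin]
  · rintro ⟨θ, hθ, hsin, hcos⟩
    refine ⟨θ + Real.pi / 2, ⟨by linarith [hθ.1], by linarith [hθ.2]⟩, ?_, ?_⟩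
    · rw [Real.sin_add_pi_div_two, hcos]
    · rw [Real.cos_add_pi_div_two, hsin, neg_neg]

theorem isQuadrant_zero : IsQuadrant 0 1 1 := by simpa using isQuadrant_neg_one.add_one

theorem isQuadrant_one : IsQuadrant 1 1 (-1) := by simpa using isQuadrant_zero.add_one

theorem isQuadrant_two : IsQuadrant 2 (-1) (-1) := by simpa using isQuadrant_one.add_one

theorem isQuadrant_three : IsQuadrant 3 (-1) 1 := by simpa using isQuadrant_two.add_one

theorem IsQuadrant.exists_sn_cn_iff {n : ℤ} {σ χ k : ℝ} (h : IsQuadrant n σ χ) (hk : |k| < 1)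
    (u : ℝ) : (∃ τ ∈ Ioo (n * ellK k) ((n + 1) * ellK k), sn τ k = sn u k ∧ cn τ k = cn u k) ↔
      0 < σ * sn u k ∧ 0 < χ * cn u k := by
  have hend : ((n : ℝ) + 1) = (n + 1 : ℤ) := by push_cast; rfl
  refine Iff.trans ⟨?_, ?_⟩ (h (am u k))
  · rintro ⟨τ, hτ, heq⟩
    refine ⟨am τ k, ⟨(lt_am_iff hk).2 ?_, (am_lt_iff hk).2 ?_⟩, heq⟩
    · rw [ellF_int_mul_pi_div_two hk]
      exact hτ.1
    · rw [hend, ellF_int_mul_pi_div_two hk, ← hend]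
      exact hτ.2
  · rintro ⟨θ, hθ, heq⟩
    refine ⟨ellF θ k, ⟨?_, ?_⟩, by rwa [sn, cn, am_ellF hk]⟩
    · rw [← ellF_int_mul_pi_div_two hk]
      exact strictMono_ellF hk hθ.1
    · rw [hend, ← ellF_int_mul_pi_div_two hk, ← hend]
      exact strictMono_ellF hk hθ.2

variable {ε δ k p u : ℝ} {s : SignType}

theorem oscState_mem_region_iff (hk : k ∈ Ioo (0 : ℝ) 1) (hp : 0 < p) :
    oscState k p u ∈ region ε δ ↔ (0 < -ε * sn u k ∧ 0 < δ * cn u k) ∧ p < p₁ k := by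
  have hdn := dn_pos (abs_lt_one_of_mem_Ioo hk) u
  have hk0 := hk.1
  have h3 : ε * h₃ (oscState k p u) = 2 * (2 * p) ^ 2 * k * dn u k * (-ε * sn u k) := by
    rw [oscState, h₃_ofHalfAngle]
    ring
  have h2 : δ * h₂ (oscState k p u) = 4 * k * p * (δ * cn u k) := by
    rw [oscState, h₂_ofHalfAngle]
    ring
  rw [region, mem_ofPred, h3, h2, modulus_oscState hk hp, rad_oscState (abs_lt_one_of_mem_Ioo hk),
    sqrt_two_mul_sq hp, mul_div_cancel_left₀ _ two_ne_zero,
    mem_stableParams_iff_of_lt_one hk.1 hk.2, ← and_assoc]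
  exact and_congr_left' (and_congr (mul_pos_iff_of_pos_left (by positivity))
    (mul_pos_iff_of_pos_left (by positivity)))

theorem rotState_mem_region_iff (hs : s ≠ 0) (hk : k ∈ Ioo (0 : ℝ) 1) (hp : 0 < p) :
    rotState s k p u ∈ region ε δ ↔
      0 < -(ε * s) * sn u k * cn u k ∧ 0 < δ * s ∧ p < ellK k := by
  have hdn := dn_pos (abs_lt_one_of_mem_Ioo hk) u
  have hk0 := hk.1
  have h3 : ε * h₃ (rotState s k p u) = 2 * (2 * k * p) ^ 2 * (-(ε * s) * sn u k * cn u k) := by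
    rw [rotState, h₃_ofHalfAngle]
    ring
  have h2 : δ * h₂ (rotState s k p u) = 4 * p * dn u k * (δ * s) := by
    rw [rotState, h₂_ofHalfAngle]
    ring
  have hsqrt : √((2 * k * p) ^ 2) / 2 = k * p := by
    rw [Real.sqrt_sq (by positivity)]
    ring
  rw [region, mem_ofPred, h3, h2, modulus_rotState hs hk hp, rad_rotState hs, hsqrt,
    mem_stableParams_iff_of_one_lt (one_lt_inv_iff₀.2 hk), inv_inv, inv_mul_cancel_left₀ hk0.ne']
  exact and_congr (mul_pos_iff_of_pos_left (by positivity))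
    (and_congr_left' (mul_pos_iff_of_pos_left (by positivity)))

theorem tanh_pos_iff : 0 < Real.tanh u ↔ 0 < u := by
  rw [Real.tanh_eq_sinh_div_cosh, div_pos_iff_of_pos_right (Real.cosh_pos u), Real.sinh_pos_iff]

theorem mul_tanh_pos_iff {a : ℝ} : 0 < a * Real.tanh u ↔ 0 < a * u := by
  have hneg : Real.tanh u < 0 ↔ u < 0 := by
    simpa only [Real.tanh_neg, neg_pos] using tanh_pos_iff (u := -u)
  rw [mul_pos_iff, mul_pos_iff, tanh_pos_iff, hneg]

theorem sepState_mem_region_iff (hs : s ≠ 0) (hp : 0 < p) :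
    sepState s p u ∈ region ε δ ↔ 0 < -(ε * s) * u ∧ 0 < δ * s := by
  have := Real.cosh_pos u
  have h3 : ε * h₃ (sepState s p u) =
      2 * (2 * p) ^ 2 * (1 / Real.cosh u) * (-(ε * s) * Real.tanh u) := by
    rw [sepState, h₃_ofHalfAngle]
    ring
  have h2 : δ * h₂ (sepState s p u) = 4 * p * (1 / Real.cosh u) * (δ * s) := by
    rw [sepState, h₂_ofHalfAngle]
    ring
  rw [region, mem_ofPred, h3, h2, modulus_sepState hs hp, and_iff_left (one_mem_stableParams _)]
  exact and_congr ((mul_pos_iff_of_pos_left (by positivity)).trans mul_tanh_pos_iff)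
    (mul_pos_iff_of_pos_left (by positivity))

theorem eq_of_coe_mul_coe_pos {s t : SignType} (h : 0 < (s * t : ℝ)) : t = s := by
  cases s <;> cases t <;> first | rfl | norm_num at h

theorem block₁_eq_preimage {n : ℤ} (h : IsQuadrant n (-ε) δ) :
    block₁ n (n + 1) = midpoint ⁻¹' (region ε δ ∩ {lam | modulus lam < 1}) := by
  ext lam
  rw [mem_block₁_iff, mem_preimage]
  generalize midpoint lam = q
  constructor
  · rintro ⟨τ, p, k, rfl, hτ, hp, hk⟩
    refine ⟨(oscState_mem_region_iff hk hp.1).2 ⟨?_, hp.2⟩, ?_⟩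
    · exact (h.exists_sn_cn_iff (abs_lt_one_of_mem_Ioo hk) τ).1 ⟨τ, hτ, rfl, rfl⟩
    · exact (modulus_oscState hk hp.1 τ).trans_lt hk.2
  · rintro ⟨hq, hκ1⟩
    have hh₃ := h₃_ne_zero_of_mem_region hq
    have hr := rad_pos_of_h₃_ne_zero hh₃
    have hκ0 := modulus_pos hr (Or.inl hh₃)
    have hp : 0 < √(rad q) / 2 := by positivity
    obtain ⟨u, hu⟩ := exists_eq_oscState hr hκ0 hκ1
    rw [hu, oscState_mem_region_iff ⟨hκ0, hκ1⟩ hp] at hq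
    obtain ⟨τ, hτ, hsn, hcn⟩ :=
      (h.exists_sn_cn_iff (abs_lt_one_of_mem_Ioo ⟨hκ0, hκ1⟩) u).2 hq.1
    refine ⟨τ, _, _, hu.trans ?_, hτ, ⟨hp, hq.2⟩, hκ0, hκ1⟩
    rw [oscState, oscState, dn, dn, hsn, hcn]

theorem block₂_eq_preimage (hs : s ≠ 0) {n : ℤ} (h : IsQuadrant n (-(ε * s)) 1) :
    block₂ s n (n + 1) = midpoint ⁻¹' (region ε s ∩ {lam | 1 < modulus lam}) := by
  ext lam
  rw [mem_block₂_iff hs, mem_preimage]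
  generalize midpoint lam = q
  constructor
  · rintro ⟨τ, p, k, rfl, hτ, hp, hk⟩
    obtain ⟨hsn, hcn⟩ := (h.exists_sn_cn_iff (abs_lt_one_of_mem_Ioo hk) τ).1 ⟨τ, hτ, rfl, rfl⟩
    rw [one_mul] at hcn
    refine ⟨(rotState_mem_region_iff hs hk hp.1).2 ⟨mul_pos hsn hcn, ?_, hp.2⟩, ?_⟩
    · rw [← sq, signType_coe_sq hs]
      exact one_pos
    · exact (one_lt_inv_iff₀.2 hk).trans_eq (modulus_rotState hs hk hp.1 τ).symm
  · rintro ⟨hq, hκ⟩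
    have hr := rad_pos_of_h₃_ne_zero (h₃_ne_zero_of_mem_region hq)
    have hκ0 : 0 < modulus q := one_pos.trans hκ
    have hk : (modulus q)⁻¹ ∈ Ioo (0 : ℝ) 1 := ⟨inv_pos.2 hκ0, inv_lt_one_of_one_lt₀ hκ⟩
    have hp : 0 < modulus q * (√(rad q) / 2) := by positivity
    obtain ⟨t, ht, u, hcn, hu⟩ := exists_eq_rotState hr hκ
    rw [hu, rotState_mem_region_iff ht hk hp] at hq
    obtain rfl := eq_of_coe_mul_coe_pos hq.2.1
    have hsn := pos_of_mul_pos_left hq.1 hcn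
    have hcn' := pos_of_mul_pos_right hq.1 hsn.le
    obtain ⟨τ, hτ, hsnτ, hcnτ⟩ :=
      (h.exists_sn_cn_iff (abs_lt_one_of_mem_Ioo hk) u).2 ⟨hsn, by rwa [one_mul]⟩
    refine ⟨τ, _, _, hu.trans ?_, hτ, ⟨hp, hq.2.2⟩, hk⟩
    rw [rotState, rotState, dn, dn, hsnτ, hcnτ]

theorem block₃_eq_preimage (hs : s ≠ 0) {I : Set ℝ} (h : ∀ u, u ∈ I ↔ 0 < -(ε * s) * u) :
    block₃ s I = midpoint ⁻¹' (region ε s ∩ {lam | modulus lam = 1}) := by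
  ext lam
  rw [mem_block₃_iff hs, mem_preimage]
  generalize midpoint lam = q
  constructor
  · rintro ⟨τ, p, rfl, hτ, hp⟩
    refine ⟨(sepState_mem_region_iff hs hp).2 ⟨(h τ).1 hτ, ?_⟩, modulus_sepState hs hp τ⟩
    rw [← sq, signType_coe_sq hs]
    exact one_pos
  · rintro ⟨hq, hκ⟩
    have hh₃ := h₃_ne_zero_of_mem_region hq
    have hr := rad_pos_of_h₃_ne_zero hh₃
    have hp : 0 < √(rad q) / 2 := by positivity
    obtain ⟨t, ht, u, hu⟩ :=
      exists_eq_sepState hr hκ (vel_ne_zero_of_modulus_eq_one hr hκ hh₃)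
    rw [hu, sepState_mem_region_iff ht hp] at hq
    obtain rfl := eq_of_coe_mul_coe_pos hq.2
    exact ⟨u, _, hu, (h u).2 hq.1, hp⟩

theorem union_eq_preimage_region (hs : s ≠ 0) {m n : ℤ} {I : Set ℝ} (hosc : IsQuadrant m (-ε) s)
    (hrot : IsQuadrant n (-(ε * s)) 1) (hsep : ∀ u, u ∈ I ↔ 0 < -(ε * s) * u) :
    block₁ m (m + 1) ∪ block₂ s n (n + 1) ∪ block₃ s I = midpoint ⁻¹' region ε s := by
  rw [block₁_eq_preimage hosc, block₂_eq_preimage hs hrot, block₃_eq_preimage hs hsep,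
    ← preimage_union, ← preimage_union, ← inter_union_distrib_left, ← inter_union_distrib_left,
    inter_eq_left.2]
  intro lam _
  rcases lt_trichotomy (modulus lam) 1 with h | h | h
  · exact Or.inl (Or.inl h)
  · exact Or.inr h
  · exact Or.inl (Or.inr h)

theorem L₁_eq_preimage_region : L₁ = midpoint ⁻¹' region (-1) 1 := by
  rw [L₁]
  convert union_eq_preimage_region (ε := -1) (s := 1) (I := Ioi 0) (by decide)
    (by simpa using isQuadrant_zero) (by simpa using isQuadrant_zero) (by simp)
    using 3 <;> norm_num

theorem L₂_eq_preimage_region : L₂ = midpoint ⁻¹' region (-1) (-1) := by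
  rw [L₂]
  convert union_eq_preimage_region (ε := -1) (s := -1) (I := Iio 0) (by decide)
    (by simpa using isQuadrant_one) (by simpa using isQuadrant_neg_one) (by simp)
    using 3 <;> norm_num

theorem L₃_eq_preimage_region : L₃ = midpoint ⁻¹' region 1 (-1) := by
  rw [L₃]
  convert union_eq_preimage_region (ε := 1) (s := -1) (I := Ioi 0) (by decide)
    (by simpa using isQuadrant_two) (by simpa using isQuadrant_zero) (by simp)
    using 3 <;> norm_num

theorem L₄_eq_preimage_region : L₄ = midpoint ⁻¹' region 1 1 := by
  rw [L₄]
  convert union_eq_preimage_region (ε := 1) (s := 1) (I := Iio 0) (by decide)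
    (by simpa using isQuadrant_three) (by simpa using isQuadrant_neg_one) (by simp)
    using 3 <;> norm_num

theorem isOpen_and_isPathConnected_preimage_midpoint (hε : ε ≠ 0) (hδ : δ ≠ 0) :
    IsOpen (midpoint ⁻¹' region ε δ) ∧ IsPathConnected (midpoint ⁻¹' region ε δ) :=
  ⟨(isOpen_region ε δ).preimage midpoint.continuous,
    midpoint.isPathConnected_preimage.2 (isPathConnected_region hε hδ)⟩

end Elastica

theorem mainTheorem3 :
    (IsOpen Elastica.L₁ ∧ IsPathConnected Elastica.L₁) ∧
    (IsOpen Elastica.L₂ ∧ IsPathConnected Elastica.L₂) ∧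
    (IsOpen Elastica.L₃ ∧ IsPathConnected Elastica.L₃) ∧
    (IsOpen Elastica.L₄ ∧ IsPathConnected Elastica.L₄) := by
  rw [Elastica.L₁_eq_preimage_region, Elastica.L₂_eq_preimage_region,
    Elastica.L₃_eq_preimage_region, Elastica.L₄_eq_preimage_region]
  refine ⟨?_, ?_, ?_, ?_⟩ <;>
    exact Elastica.isOpen_and_isPathConnected_preimage_midpoint (by simp) (by simp)
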